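/- Let $G$ be a countable directed graph (loops and multiple edges allowed) with vertex set $\mathcal V(G)$, edge set $\mathcal E(G)$ and source and range maps $s,r$. The free semigroupoid $\mathbb F^+(G)$ consists of the vertices (paths of length $0$) and all finite paths $w=e_k\cdots e_1$ with $s(e_i)=r(e_{i-1})$, where $s(w)=s(e_1)$ and $r(w)=r(e_k)$. On the Hilbert space $\mathcal H_G=\ell^2(\mathbb F^+(G))$ with its standard orthonormal basis $\{\xi_w\}$ let $L_e$ $(e\in\mathcal E(G))$ be the operator with $L_e\xi_w=\xi_{ew}$ if $s(e)=r(w)$ and $L_e\xi_w=0$ otherwise, and let $P_x$ $(x\in\mathcal V(G))$ be the projection onto the closed span of the $\xi_w$ with $r(w)=x$. The free semigroupoid algebra $\mathfrak L_G\subseteq\mathcal B(\mathcal H_G)$ is the closure in the weak operator topology of the norm-closed algebra generated by all $L_e$ and $P_x$. Its $w^*$-topology is the relative weak-$*$ (ultraweak) topology that it inherits from $\mathcal B(\mathcal H_G)$, regarded as the dual of the trace class operators. **Theorem.** Let $G$ and $G'$ be countable directed graphs that are locally finite (every vertex emits only finitely many and receives only finitely many edges) and have no sinks (every vertex emits at least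 one edge). Then every algebraic isomorphism ($\mathbb C$-linear multiplicative bijection, with no continuity assumed) $\tau:\mathfrak L_G\to\mathfrak L_{G'}$ is continuous with respect to the $w^*$-topologies of $\mathfrak L_G$ and $\mathfrak L_{G'}$. -/

import Mathlib

open scoped ENNReal Topology InnerProductSpace

universe u v u' v'

noncomputable section

namespace GraphAlgebra

/-! ### Directed graphs and their free semigroupoids

A directed graph with vertex set `V` is a quiver on `V`: the edges `e` with source `x` and range
`y` are the arrows `e : x ⟶ y`; loops and multiple edges are allowed. -/

/-- No vertex is a sink: every vertex emits at least one edge. -/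
def NoSinks (V : Type u) [Quiver.{v} V] : Prop :=
  ∀ x : V, Nonempty (Quiver.Star x)

/-- Every vertex emits finitely many edges and receives finitely many edges. -/
def LocallyFinite (V : Type u) [Quiver.{v} V] : Prop :=
  ∀ x : V, Finite (Quiver.Star x) ∧ Finite (Quiver.Costar x)

/-- The set of edges of a directed graph is countable. -/
def CountableEdges (V : Type u) [Quiver.{v} V] : Prop :=
  Countable (Σ x y : V, (x ⟶ y))

/-- The free semigroupoid (path space): all vertices (paths of length `0`) and all finite paths.
The path `e_k ⋯ e_1` has the source of `e_1` as its source and the range of `e_k` as its range;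
`p.cons e` is the path `e p`. -/
structure PathSpace (V : Type u) [Quiver.{v} V] where
  source : V
  range : V
  path : Quiver.Path source range

variable {V : Type u} [Quiver.{v} V]

/-- The vertex `x`, viewed as a path of length `0`. -/
def PathSpace.vertex (x : V) : PathSpace V := ⟨x, x, Quiver.Path.nil⟩

/-- The path `e w`, for a path `w` from `x` to `a` and an edge `e` from `a` to `b`. -/
def PathSpace.prepend {x a b : V} (e : a ⟶ b) (w : Quiver.Path x a) : PathSpace V :=
  ⟨x, b, w.cons e⟩

/-! ### Operators on `ℓ²` that permute basis vectors -/

/-- The Hilbert space `ℓ²(ι)`. -/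
abbrev L2 (ι : Type*) : Type _ := lp (fun _ : ι => ℂ) 2

/-- The vector `ξ_i`, the characteristic function of `{i}`. -/
def basisVec {ι : Type*} (i : ι) : L2 ι :=
  open Classical in lp.single 2 i (1 : ℂ)

theorem basisVec_apply {ι : Type*} [inst : DecidableEq ι] (i j : ι) :
    (basisVec i : ι → ℂ) j = if j = i then 1 else 0 := by
  obtain rfl : inst = fun a b => Classical.propDecidable (a = b) := Subsingleton.elim _ _
  classical
  rw [basisVec]
  by_cases h : j = i
  · subst h; simp
  · rw [if_neg h]
    exact lp.single_apply_ne (E := fun _ : ι => ℂ) 2 i (1 : ℂ) h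

/-- The function `j ↦ f (g j)`, extended by `0` where `g` is undefined. -/
def pullFun {ι : Type*} (g : ι → Option ι) (f : ι → ℂ) (j : ι) : ℂ :=
  (g j).elim 0 f

theorem sum_pullFun_le {ι : Type*} (g : ι → Option ι)
    (hg : ∀ i j k, g i = some k → g j = some k → i = j) (f : L2 ι) (s : Finset ι) :
    ∑ j ∈ s, ‖pullFun g f j‖ ^ (2 : ℝ≥0∞).toReal ≤ ‖f‖ ^ (2 : ℝ≥0∞).toReal := by
  classical
  have h2 : (0 : ℝ) < (2 : ℝ≥0∞).toReal := by norm_num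
  have h1 : ∑ j ∈ s, ‖pullFun g f j‖ ^ (2 : ℝ≥0∞).toReal
      = ∑ j ∈ s.filter (fun j => (g j).isSome), ‖pullFun g f j‖ ^ (2 : ℝ≥0∞).toReal := by
    rw [Finset.sum_filter]
    refine Finset.sum_congr rfl fun j _ => ?_
    cases h : g j <;> simp [pullFun, h]
  have h3 : ∑ j ∈ s.filter (fun j => (g j).isSome), ‖pullFun g f j‖ ^ (2 : ℝ≥0∞).toReal
      = ∑ k ∈ s.filterMap g (fun i j k hi hj => hg i j k hi hj),
          ‖f k‖ ^ (2 : ℝ≥0∞).toReal := by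
    refine Finset.sum_bij (fun j hj => (g j).get (Finset.mem_filter.1 hj).2) ?_ ?_ ?_ ?_
    · intro j hj
      rw [Finset.mem_filterMap]
      exact ⟨j, (Finset.mem_filter.1 hj).1, by simp⟩
    · intro i hi j hj hij
      refine hg i j ((g i).get (Finset.mem_filter.1 hi).2) (by simp) ?_
      rw [hij]; simp
    · intro k hk
      rw [Finset.mem_filterMap] at hk
      obtain ⟨j, hj, hjk⟩ := hk
      exact ⟨j, Finset.mem_filter.2 ⟨hj, by simp [hjk]⟩, by simp [hjk]⟩
    · intro j hj
      obtain ⟨k, hk⟩ := Option.isSome_iff_exists.1 (Finset.mem_filter.1 hj).2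
      simp [pullFun, hk]
  rw [h1, h3]
  exact lp.sum_rpow_le_norm_rpow h2 f _

/-- The bounded operator `f ↦ (j ↦ f (g j))` on `ℓ²(ι)`, for a partially defined injective
map `g`. It maps `ξ_k` to `ξ_j` if `g j = k`, and to `0` if `k` is not a value of `g`. -/
def pullOp {ι : Type*} (g : ι → Option ι)
    (hg : ∀ i j k, g i = some k → g j = some k → i = j) : L2 ι →L[ℂ] L2 ι :=
  LinearMap.mkContinuous
    { toFun := fun f => ⟨pullFun g f, memℓp_gen' (sum_pullFun_le g hg f)⟩
      map_add' := by
        intro f f'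
        ext j
        change pullFun g (f + f') j = pullFun g f j + pullFun g f' j
        cases h : g j <;> simp [pullFun, h]
      map_smul' := by
        intro c f
        ext j
        change pullFun g (c • f) j = c • pullFun g f j
        cases h : g j <;> simp [pullFun, h] }
    1 (by
      intro f
      rw [one_mul]
      exact lp.norm_le_of_forall_sum_le (by norm_num) (norm_nonneg f) (sum_pullFun_le g hg f))

@[simp]
theorem pullOp_apply {ι : Type*} (g : ι → Option ι)
    (hg : ∀ i j k, g i = some k → g j = some k → i = j) (f : L2 ι) (j : ι) :
    (pullOp g hg f : ι → ℂ) j = (g j).elim 0 f := rfl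

/-! ### The operators `L_e` and `P_x` -/

/-- Removal of a leading edge `e`: the path `e w` is sent to `w`, every other path to `none`. -/
def stripEdge {a b : V} (e : a ⟶ b) : PathSpace V → Option (PathSpace V)
  | ⟨_, _, .nil⟩ => none
  | ⟨x, d, .cons (b := c) p f⟩ =>
      open Classical in
      if (⟨c, d, f⟩ : Σ c d : V, (c ⟶ d)) = ⟨a, b, e⟩ then some ⟨x, c, p⟩ else none

theorem stripEdge_eq_some {a b : V} (e : a ⟶ b) (w w' : PathSpace V) :
    stripEdge e w = some w' ↔
      ∃ (x : V) (p : Quiver.Path x a), w' = ⟨x, a, p⟩ ∧ w = PathSpace.prepend e p := by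
  constructor
  · intro h
    obtain ⟨x, d, p⟩ := w
    cases p with
    | nil => simp [stripEdge] at h
    | @cons c _ p f =>
      simp only [stripEdge] at h
      split_ifs at h with hc
      cases hc
      exact ⟨x, p, (Option.some.inj h).symm, rfl⟩
  · rintro ⟨x, p, rfl, rfl⟩
    simp [stripEdge, PathSpace.prepend]

/-- The left creation operator `L_e`: `L_e ξ_w = ξ_{ew}` if the source of `e` is the range of `w`,
and `L_e ξ_w = 0` otherwise. -/
def creation {a b : V} (e : a ⟶ b) : L2 (PathSpace V) →L[ℂ] L2 (PathSpace V) :=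
  pullOp (stripEdge e) (by
    intro i j k hi hj
    obtain ⟨x, p, rfl, rfl⟩ := (stripEdge_eq_some e i k).1 hi
    obtain ⟨y, q, h, rfl⟩ := (stripEdge_eq_some e j _).1 hj
    cases h
    rfl)

/-- The projection `P_x` onto the closed span of the `ξ_w`, `w` a path with range `x`. -/
def vertexProj (x : V) : L2 (PathSpace V) →L[ℂ] L2 (PathSpace V) :=
  open Classical in
  pullOp (fun w => if w.range = x then some w else none) (by
    intro i j k hi hj
    simp only [Option.ite_none_right_eq_some, Option.some.injEq] at hi hj
    exact hi.2.trans hj.2.symm)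

theorem creation_basisVec {a b x : V} (e : a ⟶ b) (w : Quiver.Path x a) :
    creation e (basisVec ⟨x, a, w⟩) = basisVec (PathSpace.prepend e w) := by
  classical
  ext j
  rw [creation, pullOp_apply, basisVec_apply]
  by_cases h : j = PathSpace.prepend e w
  · rw [if_pos h, (stripEdge_eq_some e j ⟨x, a, w⟩).2 ⟨x, w, rfl, h⟩]
    simp [basisVec_apply]
  · rw [if_neg h]
    cases hj : stripEdge e j with
    | none => rfl
    | some k =>
      obtain ⟨y, q, rfl, rfl⟩ := (stripEdge_eq_some e j k).1 hj
      simp only [Option.elim_some, basisVec_apply]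
      rw [if_neg]
      intro hk
      cases hk
      exact h rfl

theorem creation_basisVec_of_ne {a b : V} (e : a ⟶ b) (w : PathSpace V) (h : w.range ≠ a) :
    creation e (basisVec w) = 0 := by
  classical
  ext j
  rw [creation, pullOp_apply]
  cases hj : stripEdge e j with
  | none => rfl
  | some k =>
    obtain ⟨y, q, rfl, rfl⟩ := (stripEdge_eq_some e j k).1 hj
    simp only [Option.elim_some, basisVec_apply]
    rw [if_neg]
    · rfl
    · rintro rfl
      exact h rfl

theorem vertexProj_basisVec [DecidableEq V] (x : V) (w : PathSpace V) :
    vertexProj x (basisVec w) = if w.range = x then basisVec w else 0 := by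
  classical
  ext j
  rw [vertexProj, pullOp_apply]
  by_cases hj : j = w
  · subst hj
    by_cases h : j.range = x <;> simp [h]
  · have h0 : (basisVec w : PathSpace V → ℂ) j = 0 := by rw [basisVec_apply, if_neg hj]
    by_cases h : w.range = x <;> by_cases h' : j.range = x <;> simp [h, h', h0]

/-! ### The tensor algebra and the free semigroupoid algebra -/

variable (V) in
/-- The tensor algebra of the graph: the norm closed algebra generated by all the operators
`L_e` and `P_x`. -/
def tensorAlgebra :
    NonUnitalSubalgebra ℂ (L2 (PathSpace V) →L[ℂ] L2 (PathSpace V)) :=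
  (NonUnitalAlgebra.adjoin ℂ
    ({T | ∃ (a b : V) (e : a ⟶ b), T = creation e} ∪
      {T | ∃ x : V, T = vertexProj x})).topologicalClosure

section Closure

variable {H : Type*} [NormedAddCommGroup H] [InnerProductSpace ℂ H]

theorem wot_continuous_mul_left (A : H →WOT[ℂ] H) :
    Continuous (fun B : H →WOT[ℂ] H => A * B) := by
  refine ContinuousLinearMapWOT.continuous_of_dual_apply_continuous fun x y => ?_
  exact ContinuousLinearMapWOT.continuous_dual_apply x (y.comp A.toCLM)

theorem wot_continuous_mul_right (A : H →WOT[ℂ] H) :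
    Continuous (fun B : H →WOT[ℂ] H => B * A) := by
  refine ContinuousLinearMapWOT.continuous_of_dual_apply_continuous fun x y => ?_
  exact ContinuousLinearMapWOT.continuous_dual_apply (A x) y

/-- The closure of an algebra of operators in the weak operator topology. -/
def wotClosure (S : NonUnitalSubalgebra ℂ (H →L[ℂ] H)) :
    NonUnitalSubalgebra ℂ (H →L[ℂ] H) where
  carrier := {T | (ContinuousLinearMapWOT.ofCLM T : H →WOT[ℂ] H) ∈
    closure (ContinuousLinearMapWOT.ofCLM '' (S : Set (H →L[ℂ] H)))}
  zero_mem' := subset_closure ⟨0, S.zero_mem, rfl⟩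
  add_mem' := by
    intro A B hA hB
    refine map_mem_closure₂ (f := fun X Y : H →WOT[ℂ] H => X + Y) continuous_add hA hB ?_
    rintro _ ⟨X, hX, rfl⟩ _ ⟨Y, hY, rfl⟩
    exact ⟨X + Y, S.add_mem hX hY, rfl⟩
  smul_mem' := by
    intro c A hA
    refine map_mem_closure (f := fun X : H →WOT[ℂ] H => c • X) (continuous_const_smul c) hA ?_
    rintro _ ⟨X, hX, rfl⟩
    exact ⟨c • X, SMulMemClass.smul_mem c hX, rfl⟩
  mul_mem' := by
    intro A B hA hB
    have key : ∀ X ∈ S, (ContinuousLinearMapWOT.ofCLM (X * B) : H →WOT[ℂ] H) ∈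
        closure (ContinuousLinearMapWOT.ofCLM '' (S : Set (H →L[ℂ] H))) := by
      intro X hX
      change (ContinuousLinearMapWOT.ofCLM X * ContinuousLinearMapWOT.ofCLM B : H →WOT[ℂ] H) ∈ _
      refine map_mem_closure (wot_continuous_mul_left (ContinuousLinearMapWOT.ofCLM X)) hB ?_
      rintro _ ⟨Y, hY, rfl⟩
      exact ⟨X * Y, S.mul_mem hX hY, rfl⟩
    have := map_mem_closure (wot_continuous_mul_right (ContinuousLinearMapWOT.ofCLM B)) hA
      (t := closure (ContinuousLinearMapWOT.ofCLM '' (S : Set (H →L[ℂ] H)))) (by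
        rintro _ ⟨X, hX, rfl⟩
        exact key X hX)
    rwa [closure_closure] at this

/-! ### The weak-star topology -/

/-- The weak-star (ultraweak) topology on `B(H)`, viewed as the dual of the trace class operators:
the coarsest topology that makes continuous all functionals `T ↦ ∑ₙ ⟨yₙ, T xₙ⟩` with
`∑ₙ ‖xₙ‖² < ∞` and `∑ₙ ‖yₙ‖² < ∞`. -/
@[reducible]
def weakStarTopology (H : Type*) [NormedAddCommGroup H] [InnerProductSpace ℂ H] :
    TopologicalSpace (H →L[ℂ] H) :=
  ⨅ p : lp (fun _ : ℕ => H) 2 × lp (fun _ : ℕ => H) 2,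
    TopologicalSpace.induced (fun T : H →L[ℂ] H => ∑' n, ⟪p.2 n, T (p.1 n)⟫_ℂ) inferInstance

/-- The series that define the ultraweakly continuous functionals converge. -/
theorem summable_weakStar (T : H →L[ℂ] H) (x y : lp (fun _ : ℕ => H) 2) :
    Summable fun n => ⟪y n, T (x n)⟫_ℂ := by
  have hT : Memℓp (fun n => T (x n)) 2 := by
    have hx := (lp.memℓp x).summable (by norm_num : (0 : ℝ) < (2 : ℝ≥0∞).toReal)
    refine memℓp_gen (Summable.of_nonneg_of_le (fun n => by positivity) (fun n => ?_)
      (hx.mul_left (‖T‖ ^ (2 : ℝ≥0∞).toReal)))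
    rw [← Real.mul_rpow (norm_nonneg _) (norm_nonneg _)]
    exact Real.rpow_le_rpow (norm_nonneg _) (T.le_opNorm _) (by norm_num)
  exact lp.summable_inner (𝕜 := ℂ) y ⟨_, hT⟩

end Closure

theorem vertexProj_mem_tensorAlgebra (x : V) : vertexProj x ∈ tensorAlgebra V :=
  NonUnitalSubalgebra.le_topologicalClosure _
    (NonUnitalAlgebra.subset_adjoin ℂ (Or.inr ⟨x, rfl⟩))

/-- The projections `P_x` sum to the identity in the weak operator topology. It contains the identity operator, the sum of the `P_x`. -/
theorem hasSum_vertexProj :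
    HasSum (fun x : V => (ContinuousLinearMapWOT.ofCLM (vertexProj x) :
      L2 (PathSpace V) →WOT[ℂ] L2 (PathSpace V))) 1 := by
  classical
  rw [HasSum, ContinuousLinearMapWOT.tendsto_iff_forall_inner_apply_tendsto]
  intro f g
  have h := (lp.hasSum_inner (𝕜 := ℂ) g f).tsum_fiberwise (fun w : PathSpace V => w.range)
  refine Filter.Tendsto.congr (fun s => ?_) h
  have hsum : ((∑ x ∈ s, (ContinuousLinearMapWOT.ofCLM (vertexProj x) :
      L2 (PathSpace V) →WOT[ℂ] L2 (PathSpace V))) f) = ∑ x ∈ s, vertexProj x f := by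
    induction s using Finset.induction_on with
    | empty => simp
    | insert a s ha ih =>
      rw [Finset.sum_insert ha, Finset.sum_insert ha, ContinuousLinearMapWOT.add_apply, ih]
      rfl
  rw [hsum, inner_sum]
  refine Finset.sum_congr rfl fun x _ => ?_
  rw [lp.inner_eq_tsum]
  refine (tsum_subtype ((fun w : PathSpace V => w.range) ⁻¹' {x})
    (fun w => ⟪g w, f w⟫_ℂ)).trans ?_
  refine tsum_congr fun w => ?_
  by_cases hw : w.range = x <;> simp [vertexProj, hw, Set.indicator]

variable (V) in
/-- The free semigroupoid algebra `𝔏_G`: the closure of the tensor algebra in the weak operator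
topology. -/
def freeSemigroupoidAlgebra :
    Subalgebra ℂ (L2 (PathSpace V) →L[ℂ] L2 (PathSpace V)) where
  __ := wotClosure (tensorAlgebra V)
  algebraMap_mem' c := by
    have h1 : (1 : L2 (PathSpace V) →L[ℂ] L2 (PathSpace V)) ∈ wotClosure (tensorAlgebra V) := by
      refine mem_closure_of_tendsto hasSum_vertexProj (Filter.Eventually.of_forall fun s => ?_)
      refine ⟨∑ x ∈ s, vertexProj x,
        sum_mem fun x _ => vertexProj_mem_tensorAlgebra x, ?_⟩
      exact map_sum ContinuousLinearMapWOT.addEquiv.symm _ s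
    rw [Algebra.algebraMap_eq_smul_one]
    exact SMulMemClass.smul_mem c h1

variable (V) in
/-- The weak-star topology on `𝔏_G`: the relative topology from `B(ℓ²(𝔽⁺(G)))`. -/
@[reducible]
def freeSemigroupoidAlgebra.weakStar : TopologicalSpace (freeSemigroupoidAlgebra V) :=
  TopologicalSpace.induced Subtype.val (weakStarTopology (L2 (PathSpace V)))

end GraphAlgebra

end

/-! The proof has three stages.

Norm continuity. Fix a vector `f` and a path `u` and consider the functional `a ↦ (τ(a) f)(u)`. If
it is discontinuous, so is the one at `e u` for every edge `e` that can be prepended, because left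
multiplication by `τ⁻¹(L_e)` is continuous. As there are no sinks, this propagates along an infinite
path. Either that path meets a vertex twice, which gives a cycle and the powers of one operator
`L_p`, or its vertices are distinct, which gives the projections `P_x`. In both cases `gliding_hump`
yields a contradiction. Since coordinates separate operators, the closed graph theorem gives
`continuous_algEquiv`, which serves for `τ` and for `τ⁻¹`.

Bounded sets. Every `B` in the algebra expands as `P_y B = φ_y(B) P_y + ∑ L_e B_e` over the finitely
many edges `e` with range `y`, and each `B_e` lies in the algebra. Let a bounded family `A_i`
converge weakly to `A₀` along an ultrafilter. Transport the expansions of `τ(A_i)` by `τ⁻¹`, pass to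
the limit there by compactness, and apply `τ` again. The result is an expansion of `P_y τ(A₀)` whose
coefficients are limits. Uniqueness of coefficients and induction on path length give convergence of
all coordinates of `τ(A_i) f`; this is `tendsto_coord_of_wot`.

Duality. For bounded families, coordinatewise convergence yields weak operator and then ultraweak
convergence. Hence a w*-continuous functional composed with `τ` is weak-operator continuous at `0`
on the unit ball, and the Krein-Smulian type statement `mem_range_predualMap` makes it
w*-continuous. -/

noncomputable section

namespace GraphAlgebra

/-! ### A gliding hump argument -/

section GlidingHump

variable {X : Type*} [NormedAddCommGroup X] [NormedSpace ℂ X]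

theorem exists_norm_le_and_le_norm_apply (g : X →ₗ[ℂ] ℂ) (hg : ¬ Continuous g) {δ : ℝ} (hδ : 0 < δ)
    (K : ℝ) : ∃ x, ‖x‖ ≤ δ ∧ K ≤ ‖g x‖ := by
  by_contra! h
  refine hg (AddMonoidHomClass.continuous_of_bound g (K / δ) ?_)
  refine LinearMap.bound_of_ball_bound' hδ K g fun z hz => (h z ?_).le
  simpa using hz

/-- The product `t_N t_{N+1} ⋯ t_{N+j-1}`. -/
def chainProd (t : ℕ → X →L[ℂ] X) : ℕ → ℕ → X →L[ℂ] X
  | _, 0 => 1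
  | N, j + 1 => t N * chainProd t (N + 1) j

/-- Keeping the factors with index below `N` on the left makes the induction telescope when `N`
moves to `N + 1`. -/
theorem norm_chainProd_mul_le (t : ℕ → X →L[ℂ] X) (N j : ℕ) :
    ‖chainProd t N j‖ * ∏ i ∈ Finset.range N, (1 + ‖t i‖) ≤
      ∏ i ∈ Finset.range (N + j), (1 + ‖t i‖) := by
  induction j generalizing N with
  | zero =>
    refine mul_le_of_le_one_left (by positivity) ?_
    exact ContinuousLinearMap.norm_id_le
  | succ j ih =>
    have h := ih (N + 1)
    rw [Finset.prod_range_succ] at h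
    rw [show N + (j + 1) = N + 1 + j by ring]
    refine le_trans ?_ h
    have h1 : ‖chainProd t N (j + 1)‖ ≤ ‖t N‖ * ‖chainProd t (N + 1) j‖ := norm_mul_le _ _
    have h2 : 0 ≤ ∏ i ∈ Finset.range N, (1 + ‖t i‖) := by positivity
    calc _ ≤ ‖t N‖ * ‖chainProd t (N + 1) j‖ * ∏ i ∈ Finset.range N, (1 + ‖t i‖) := by gcongr
      _ ≤ (1 + ‖t N‖) * ‖chainProd t (N + 1) j‖ * ∏ i ∈ Finset.range N, (1 + ‖t i‖) := by
        gcongr; linarith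
      _ = _ := by ring

/-- Let `w_n = t_0 ⋯ t_{n-1}`. It is impossible that all functionals of a pointwise bounded
sequence `f_n` satisfy: `f_n ∘ w_n` is discontinuous and `f_n ∘ w_{n+1}` is continuous. -/
theorem gliding_hump [CompleteSpace X] (t w : ℕ → X →L[ℂ] X) (hw0 : w 0 = 1)
    (hw : ∀ n, w (n + 1) = w n * t n) (f : ℕ → X →ₗ[ℂ] ℂ)
    (hb : ∀ x, ∃ C, ∀ n, ‖f n x‖ ≤ C)
    (hd : ∀ n, ¬ Continuous fun x => f n (w n x))
    (hc : ∀ n, Continuous fun x => f n (w (n + 1) x)) : False := by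
  -- `Q n` dominates the norm of every product `t_N ⋯ t_{n-1}`. Choosing `x_n` of size at most `2⁻ⁿ
  -- / Q n` makes all the tail series below converge at once.
  set Q : ℕ → ℝ := fun n => ∏ i ∈ Finset.range n, (1 + ‖t i‖) with hQ
  have hQ1 : ∀ n, 1 ≤ Q n := fun n => Finset.prod_induction _ (1 ≤ ·)
    (fun _ _ ha hb => one_le_mul_of_one_le_of_one_le ha hb) le_rfl fun i _ => by
      have := norm_nonneg (t i); linarith
  have hQ0 : ∀ n, 0 < Q n := fun n => one_pos.trans_le (hQ1 n)
  have hC : ∀ n, ∃ C, ∀ x, ‖f n (w (n + 1) x)‖ ≤ C * ‖x‖ := fun n => by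
    let g : X →L[ℂ] ℂ := ⟨(f n).comp (w (n + 1)).toLinearMap, hc n⟩
    exact ⟨‖g‖, fun x => g.le_opNorm x⟩
  choose C hC using hC
  -- The lower bound pays for the earlier terms, through `‖f n s‖`, and for the later ones, through
  -- `|C n| * 2`, and still leaves `n`.
  have hpick : ∀ n (s : X), ∃ x, ‖x‖ ≤ (1 / 2) ^ n / Q n ∧
      n + |C n| * 2 + ‖f n s‖ ≤ ‖f n (w n x)‖ := fun n s =>
    exists_norm_le_and_le_norm_apply ((f n).comp (w n).toLinearMap) (hd n)
      (by have := hQ0 n; positivity) _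
  choose pick hpick1 hpick2 using hpick
  let s : ℕ → X := fun n => Nat.rec 0 (fun n s => s + w n (pick n s)) n
  have hs : ∀ n, s (n + 1) = s n + w n (pick n (s n)) := fun n => rfl
  set x : ℕ → X := fun n => pick n (s n) with hx
  have hterm : ∀ N j, ‖chainProd t N j (x (N + j))‖ ≤ 1 / 2 ^ j := fun N j => by
    have h1 : ‖chainProd t N j‖ ≤ Q (N + j) :=
      (le_mul_of_one_le_right (norm_nonneg _) (hQ1 N)).trans (norm_chainProd_mul_le t N j)
    calc _ ≤ ‖chainProd t N j‖ * ‖x (N + j)‖ := ContinuousLinearMap.le_opNorm _ _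
      _ ≤ Q (N + j) * ((1 / 2) ^ (N + j) / Q (N + j)) := by
        gcongr
        exact hpick1 _ _
      _ = (1 / 2) ^ (N + j) := by field_simp [(hQ0 (N + j)).ne']
      _ ≤ (1 / 2) ^ j := pow_le_pow_of_le_one (by norm_num) (by norm_num) (by omega)
      _ = _ := by simp
  have hgeo : HasSum (fun j : ℕ => (1 : ℝ) / 2 ^ j) 2 := by
    simpa using hasSum_geometric_two
  have hsum : ∀ N, Summable fun j => chainProd t N j (x (N + j)) := fun N =>
    Summable.of_norm_bounded hgeo.summable (hterm N)
  set y : ℕ → X := fun N => ∑' j, chainProd t N j (x (N + j)) with hy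
  have hy2 : ∀ N, ‖y N‖ ≤ 2 := fun N => tsum_of_norm_bounded hgeo (hterm N)
  have hrec : ∀ N, y N = x N + t N (y (N + 1)) := fun N => by
    rw [hy]
    simp only
    rw [(hsum N).tsum_eq_zero_add, (t N).map_tsum (hsum (N + 1))]
    congr 1
    refine tsum_congr fun j => ?_
    rw [show N + (j + 1) = N + 1 + j by ring]
    rfl
  -- `y 0` is the sum of all `w_n x_n`; the remainder after `n` terms factors through `w_n`, and `‖y
  -- n‖ ≤ 2` uniformly in `n`.
  have hpartial : ∀ n, y 0 = s n + w n (y n) := fun n => by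
    induction n with
    | zero => simp [s, hw0]
    | succ n ih =>
      rw [ih, hs, hw, hrec n]
      simp [hx, add_assoc]
  obtain ⟨K, hK⟩ := hb (y 0)
  obtain ⟨n, hn⟩ := exists_nat_gt K
  have e1 : f n (y 0) = f n (s n) + f n (w n (x n)) + f n (w (n + 1) (y (n + 1))) := by
    rw [hpartial (n + 1), hs, map_add, map_add]
  have e2 : ‖f n (w (n + 1) (y (n + 1)))‖ ≤ |C n| * 2 := by
    refine (hC n _).trans ?_
    gcongr
    · exact le_abs_self _
    · exact hy2 _
  have e3 := hpick2 n (s n)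
  have e4 : ‖f n (w n (x n))‖ ≤ ‖f n (y 0)‖ + ‖f n (s n)‖ + ‖f n (w (n + 1) (y (n + 1)))‖ := by
    have : f n (w n (x n)) = f n (y 0) - f n (s n) - f n (w (n + 1) (y (n + 1))) := by
      rw [e1]; ring
    rw [this]
    exact (norm_sub_le _ _).trans (by gcongr; exact norm_sub_le _ _)
  have e5 := hK n
  change n + |C n| * 2 + ‖f n (s n)‖ ≤ ‖f n (w n (x n))‖ at e3
  linarith

end GlidingHump

/-! ### Operators from sesquilinear forms -/

section Predual

variable {H : Type*} [NormedAddCommGroup H] [InnerProductSpace ℂ H]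

theorem exists_clm_of_form [CompleteSpace H] (f : H → H → ℂ) (C : ℝ) (hC : 0 ≤ C)
    (add_left : ∀ x x' y, f (x + x') y = f x y + f x' y)
    (smul_left : ∀ (c : ℂ) x y, f (c • x) y = c * f x y)
    (add_right : ∀ x y y', f x (y + y') = f x y + f x y')
    (smul_right : ∀ (c : ℂ) x y, f x (c • y) = (starRingEnd ℂ) c * f x y)
    (hf : ∀ x y, ‖f x y‖ ≤ C * ‖x‖ * ‖y‖) :
    ∃ T : H →L[ℂ] H, ‖T‖ ≤ C ∧ ∀ x y, ⟪y, T x⟫_ℂ = f x y := by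
  -- Conjugating `f` gives the variance that `continuousLinearMapOfBilin` expects: antilinear in
  -- `x`, linear in `y`.
  let B : H →ₗ⋆[ℂ] H →ₗ[ℂ] ℂ := LinearMap.mk₂'ₛₗ (starRingEnd ℂ) (RingHom.id ℂ)
    (fun x y => (starRingEnd ℂ) (f x y))
    (fun x x' y => by simp [add_left]) (fun c x y => by simp [smul_left])
    (fun x y y' => by simp [add_right]) (fun c x y => by simp [smul_right])
  let B' : H →L⋆[ℂ] H →L[ℂ] ℂ := B.mkContinuous₂ C fun x y => by simpa [B] using hf x y
  have key : ∀ x y, ⟪y, InnerProductSpace.continuousLinearMapOfBilin B' x⟫_ℂ = f x y := by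
    intro x y
    rw [← inner_conj_symm, InnerProductSpace.continuousLinearMapOfBilin_apply]
    simp [B', B]
  refine ⟨InnerProductSpace.continuousLinearMapOfBilin B', ?_, key⟩
  refine ContinuousLinearMap.opNorm_le_bound _ hC fun x => ?_
  set z := InnerProductSpace.continuousLinearMapOfBilin B' x with hz
  by_cases h0 : ‖z‖ = 0
  · rw [h0]; positivity
  · have h1 : ‖z‖ * ‖z‖ ≤ C * ‖x‖ * ‖z‖ := by
      calc ‖z‖ * ‖z‖ = ‖⟪z, z⟫_ℂ‖ := (inner_self_eq_norm_mul_norm (𝕜 := ℂ) z ▸ by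
            rw [inner_self_eq_norm_sq_to_K]; simp [sq])
        _ = ‖f x z‖ := by rw [← key]
        _ ≤ _ := hf x z
    exact le_of_mul_le_mul_right h1 (lt_of_le_of_ne (norm_nonneg _) (Ne.symm h0))

/-! ### Closed range -/

/-- The induced injection on `E ⧸ ker Φ` is bounded below by `1`. A norming functional of a class
lifts to `E`, vanishes on the kernel, and so is evaluation at some `T` of norm at most `1`; this
gives `‖q‖ ≤ ‖Φ a‖`. -/
theorem isClosed_range_of_forall_dual {E X : Type*} [NormedAddCommGroup E] [NormedSpace ℂ E]
    [CompleteSpace E] [NormedAddCommGroup X] [NormedSpace ℂ X] (Φ : E →L[ℂ] StrongDual ℂ X)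
    (h : ∀ F : StrongDual ℂ E, (∀ a, Φ a = 0 → F a = 0) →
      ∃ T : X, ‖T‖ ≤ ‖F‖ ∧ ∀ a, F a = Φ a T) : IsClosed (Set.range Φ) := by
  let N : Submodule ℂ E := Φ.ker
  have : IsClosed (N : Set E) := Φ.isClosed_ker
  let j : E ⧸ N →L[ℂ] StrongDual ℂ X := N.liftQL Φ le_rfl
  have hj : Set.range Φ = Set.range j := by
    ext g
    constructor
    · rintro ⟨a, rfl⟩
      exact ⟨N.mkQ a, rfl⟩
    · rintro ⟨q, rfl⟩
      obtain ⟨a, rfl⟩ := N.mkQ_surjective q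
      exact ⟨a, rfl⟩
  rw [hj]
  refine AntilipschitzWith.isClosed_range (K := 1) ?_ j.uniformContinuous
  refine AddMonoidHomClass.antilipschitz_of_bound j fun q => ?_
  obtain ⟨g, hg1, hg2⟩ := exists_dual_vector'' ℂ q
  let F : StrongDual ℂ E := g.comp N.mkQL
  have hF : ‖F‖ ≤ 1 := ContinuousLinearMap.opNorm_le_bound _ zero_le_one fun a => by
    calc ‖g (N.mkQ a)‖ ≤ ‖g‖ * ‖N.mkQ a‖ := g.le_opNorm _
      _ ≤ 1 * ‖a‖ := by
        gcongr
        exact Submodule.Quotient.norm_mk_le N a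
  obtain ⟨T, hT, hFT⟩ := h F fun a ha => by
    change g (N.mkQ a) = 0
    rw [show N.mkQ a = 0 from (Submodule.Quotient.mk_eq_zero N).2 ha, map_zero]
  obtain ⟨a, rfl⟩ := N.mkQ_surjective q
  have h1 : ((‖N.mkQ a‖ : ℝ) : ℂ) = Φ a T := by rw [← hFT]; exact hg2.symm
  have h2 : ‖N.mkQ a‖ = ‖Φ a T‖ := by rw [← h1]; simp
  rw [h2, NNReal.coe_one, one_mul]
  calc ‖Φ a T‖ ≤ ‖Φ a‖ * ‖T‖ := (Φ a).le_opNorm T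
    _ ≤ ‖Φ a‖ * 1 := by gcongr; exact hT.trans hF
    _ = ‖j (N.mkQ a)‖ := by rw [mul_one]; rfl

/-! ### Linear maps on `ℓ¹` -/

theorem summable_norm_l1 {S : Type*} (a : lp (fun _ : S => ℂ) 1) : Summable fun s => ‖a s‖ := by
  simpa using (lp.memℓp a).summable (by norm_num)

theorem norm_l1 {S : Type*} (a : lp (fun _ : S => ℂ) 1) : ‖a‖ = ∑' s, ‖a s‖ := by
  simpa using lp.norm_eq_tsum_rpow (by norm_num) a

theorem summable_l1_smul {S Z : Type*} [NormedAddCommGroup Z] [NormedSpace ℂ Z] [CompleteSpace Z]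
    (ω : S → Z) (hω : ∀ s, ‖ω s‖ ≤ 1) (a : lp (fun _ : S => ℂ) 1) :
    Summable fun s => a s • ω s :=
  Summable.of_norm_bounded (summable_norm_l1 a) fun s => by
    rw [norm_smul]
    exact mul_le_of_le_one_right (norm_nonneg _) (hω s)

/-- The linear map on `ℓ¹(S)` that sends the unit vectors to the vectors `ω s`. -/
def l1Lift {S Z : Type*} [NormedAddCommGroup Z] [NormedSpace ℂ Z] [CompleteSpace Z]
    (ω : S → Z) (hω : ∀ s, ‖ω s‖ ≤ 1) : lp (fun _ : S => ℂ) 1 →L[ℂ] Z :=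
  LinearMap.mkContinuous
    { toFun := fun a => ∑' s, a s • ω s
      map_add' := fun a b => by
        rw [← (summable_l1_smul ω hω a).tsum_add (summable_l1_smul ω hω b)]
        simp [add_smul]
      map_smul' := fun c a => by
        simp only [RingHom.id_apply]
        rw [← (summable_l1_smul ω hω a).tsum_const_smul c]
        simp [smul_smul] }
    1 fun a => by
      rw [one_mul, norm_l1]
      refine tsum_of_norm_bounded (summable_norm_l1 a).hasSum fun s => ?_
      rw [norm_smul]
      exact mul_le_of_le_one_right (norm_nonneg _) (hω s)

theorem l1Lift_apply {S Z : Type*} [NormedAddCommGroup Z] [NormedSpace ℂ Z] [CompleteSpace Z]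
    (ω : S → Z) (hω : ∀ s, ‖ω s‖ ≤ 1) (a : lp (fun _ : S => ℂ) 1) :
    l1Lift ω hω a = ∑' s, a s • ω s := rfl

/-- The unit vectors of `ℓ¹`. -/
def l1Unit {S : Type*} (s : S) : lp (fun _ : S => ℂ) 1 :=
  open Classical in lp.single 1 s (1 : ℂ)

theorem l1Lift_unit {S Z : Type*} [NormedAddCommGroup Z] [NormedSpace ℂ Z] [CompleteSpace Z]
    (ω : S → Z) (hω : ∀ s, ‖ω s‖ ≤ 1) (s : S) : l1Lift ω hω (l1Unit s) = ω s := by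
  classical
  rw [l1Lift_apply, tsum_eq_single s]
  · simp [l1Unit]
  · intro s' hs'
    simp [l1Unit, lp.single_apply, hs']

theorem norm_l1Unit {S : Type*} (s : S) : ‖l1Unit s‖ = 1 := by
  classical
  simp [l1Unit, lp.norm_single]

theorem hasSum_dual_l1 {S : Type*} (F : StrongDual ℂ (lp (fun _ : S => ℂ) 1))
    (a : lp (fun _ : S => ℂ) 1) : HasSum (fun s => a s * F (l1Unit s)) (F a) := by
  classical
  have h := F.hasSum (lp.hasSum_single ENNReal.one_ne_top a)
  have h1 : (fun s => a s * F (l1Unit s)) = fun s => F (lp.single 1 s (a s)) := by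
    funext s
    rw [l1Unit, ← smul_eq_mul, ← map_smul, ← lp.single_smul, smul_eq_mul, mul_one]
  rw [h1]
  exact h

/-! ### The predual of a weak-operator closed space of operators. -/

variable {X : Type*} [NormedAddCommGroup X] [NormedSpace ℂ X]

/-- The functional `T ↦ ⟪y, T x⟫` on a space `X` of operators. -/
def vecFunctional (J : X →ₗᵢ[ℂ] (H →L[ℂ] H)) (x y : H) : StrongDual ℂ X :=
  ((innerSL ℂ y).comp (ContinuousLinearMap.apply ℂ H x)).comp J.toContinuousLinearMap

@[simp]
theorem vecFunctional_apply (J : X →ₗᵢ[ℂ] (H →L[ℂ] H)) (x y : H) (T : X) :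
    vecFunctional J x y T = ⟪y, J T x⟫_ℂ := rfl

theorem norm_vecFunctional_le (J : X →ₗᵢ[ℂ] (H →L[ℂ] H)) (x y : H) :
    ‖vecFunctional J x y‖ ≤ ‖x‖ * ‖y‖ := by
  refine ContinuousLinearMap.opNorm_le_bound _ (by positivity) fun T => ?_
  rw [vecFunctional_apply]
  calc _ ≤ ‖y‖ * ‖J T x‖ := norm_inner_le_norm _ _
    _ ≤ ‖y‖ * (‖J T‖ * ‖x‖) := by gcongr; exact ContinuousLinearMap.le_opNorm _ _
    _ = _ := by rw [J.norm_map]; ring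

/-- The unit vector in the direction of `x`, or `0`. -/
def unitVec (x : H) : H := ((‖x‖ : ℂ)⁻¹) • x

theorem norm_unitVec_le (x : H) : ‖unitVec x‖ ≤ 1 := by
  rw [unitVec, norm_smul, norm_inv, Complex.norm_real, norm_norm]
  exact inv_mul_le_one

theorem norm_smul_unitVec (x : H) : (‖x‖ : ℂ) • unitVec x = x := by
  by_cases h : x = 0
  · simp [h]
  · rw [unitVec, smul_smul, mul_inv_cancel₀ (by simpa using h), one_smul]

theorem norm_vecFunctional_unitVec_le (J : X →ₗᵢ[ℂ] (H →L[ℂ] H)) (s : H × H) :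
    ‖vecFunctional J (unitVec s.1) (unitVec s.2)‖ ≤ 1 :=
  (norm_vecFunctional_le J _ _).trans
    (mul_le_one₀ (norm_unitVec_le _) (norm_nonneg _) (norm_unitVec_le _))

/-- The map from `ℓ¹(H × H)` onto the predual of `X`. -/
def predualMap (J : X →ₗᵢ[ℂ] (H →L[ℂ] H)) :
    lp (fun _ : H × H => ℂ) 1 →L[ℂ] StrongDual ℂ X :=
  l1Lift (fun s => vecFunctional J (unitVec s.1) (unitVec s.2)) (norm_vecFunctional_unitVec_le J)

/-- An element of `ℓ¹(H × H)` that represents the functional `T ↦ ⟪y, T x⟫`. -/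
def predualUnit (x y : H) : lp (fun _ : H × H => ℂ) 1 := ((‖x‖ : ℂ) * ‖y‖) • l1Unit (x, y)

theorem predualMap_unit (J : X →ₗᵢ[ℂ] (H →L[ℂ] H)) (x y : H) :
    predualMap J (predualUnit x y) = vecFunctional J x y := by
  rw [predualUnit, map_smul, predualMap, l1Lift_unit]
  ext T
  simp only [smul_apply, vecFunctional_apply, smul_eq_mul]
  conv_rhs => rw [← norm_smul_unitVec x, ← norm_smul_unitVec y]
  rw [map_smul, inner_smul_left, inner_smul_right]
  simp
  ring

omit [InnerProductSpace ℂ H] in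
theorem norm_predualUnit (x y : H) : ‖predualUnit x y‖ = ‖x‖ * ‖y‖ := by
  rw [predualUnit, norm_smul, norm_l1Unit]
  simp

/-- A space of operators that is closed in the weak operator topology contains every operator
which agrees on each finite set of pairs of vectors with an element of the space. -/
theorem mem_of_forall_finset_agree [CompleteSpace H] {S : Set (H →L[ℂ] H)}
    (hS : IsClosed {T : H →WOT[ℂ] H | T.toCLM ∈ S}) (T : H →L[ℂ] H)
    (h : ∀ s : Finset (H × H), ∃ A ∈ S, ∀ p ∈ s, ⟪p.2, A p.1⟫_ℂ = ⟪p.2, T p.1⟫_ℂ) : T ∈ S := by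
  choose A hA hAT using h
  refine hS.mem_of_tendsto (x := ContinuousLinearMapWOT.ofCLM T)
    (f := fun s => ContinuousLinearMapWOT.ofCLM (A s)) (b := Filter.atTop) ?_
    (Filter.Eventually.of_forall hA)
  rw [ContinuousLinearMapWOT.tendsto_iff_forall_inner_apply_tendsto]
  intro x y
  refine tendsto_const_nhds.congr' ?_
  filter_upwards [Filter.eventually_ge_atTop {(x, y)}] with s hs
  exact (hAT s (x, y) (hs (Finset.mem_singleton_self _))).symm

/-- Functionals on `ℓ¹(H × H)` that vanish on the kernel of `predualMap` are elements of `X`. -/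
theorem exists_of_vanish_ker [CompleteSpace H] {J : X →ₗᵢ[ℂ] (H →L[ℂ] H)}
    (hJ : IsClosed {T : H →WOT[ℂ] H | T.toCLM ∈ Set.range J})
    (F : StrongDual ℂ (lp (fun _ : H × H => ℂ) 1)) (hF : ∀ a, predualMap J a = 0 → F a = 0) :
    ∃ T : X, ‖T‖ ≤ ‖F‖ ∧ ∀ a, F a = predualMap J a T := by
  classical
  -- `F` depends only on the image in the predual, where `(x, y) ↦ vecFunctional J x y` is
  -- sesquilinear; `predualUnit` itself is not.
  have hF' : ∀ a b, predualMap J a = predualMap J b → F a = F b := fun a b hab => by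
    rw [← sub_eq_zero, ← map_sub]
    exact hF _ (by rw [map_sub, hab, sub_self])
  obtain ⟨T, hT, hTF⟩ := exists_clm_of_form (fun x y : H => F (predualUnit x y)) ‖F‖
    (norm_nonneg _)
    (fun x x' y => by
      rw [← map_add]; refine hF' _ _ ?_
      ext A; simp [predualMap_unit])
    (fun c x y => by
      rw [← smul_eq_mul, ← map_smul]; refine hF' _ _ ?_
      ext A; simp [predualMap_unit])
    (fun x y y' => by
      rw [← map_add]; refine hF' _ _ ?_
      ext A; simp [predualMap_unit])
    (fun c x y => by
      rw [← smul_eq_mul, ← map_smul]; refine hF' _ _ ?_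
      ext A; simp [predualMap_unit, mul_comm])
    (fun x y => by
      have := F.le_opNorm (predualUnit x y)
      rwa [norm_predualUnit, ← mul_assoc] at this)
  have hTX : T ∈ Set.range J := by
    refine mem_of_forall_finset_agree hJ T fun s => ?_
    let e : (H →L[ℂ] H) →ₗ[ℂ] (s → ℂ) :=
      LinearMap.pi fun p =>
        ((innerSL ℂ p.1.2).comp (ContinuousLinearMap.apply ℂ H p.1.1)).toLinearMap
    have he : ∀ A p, e A p = ⟪p.1.2, A p.1.1⟫_ℂ := fun A p => rfl
    suffices h : e T ∈ LinearMap.range (e.comp J.toLinearMap) by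
      obtain ⟨A, hAT⟩ := h
      refine ⟨J A, ⟨A, rfl⟩, fun p hp => ?_⟩
      exact congrFun hAT ⟨p, hp⟩
    -- A functional `φ` that separates `e T` from the values of `X` gives a finite combination of
    -- the `predualUnit`s in the kernel of `predualMap J`. There `F` must vanish, while its value is
    -- `φ (e T) ≠ 0`.
    by_contra hmem
    obtain ⟨φ, hφ1, hφ2⟩ := Submodule.exists_dual_map_eq_bot_of_notMem hmem inferInstance
    have hφ : ∀ A, φ (e A) = ∑ p : s, φ (Pi.single p 1) * ⟪p.1.2, A p.1.1⟫_ℂ := fun A => by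
      conv_lhs => rw [LinearMap.pi_apply_eq_sum_univ φ (e A)]
      refine Finset.sum_congr rfl fun p _ => ?_
      rw [he, smul_eq_mul, mul_comm]
      congr 2
      ext q
      simp [Pi.single_apply, eq_comm]
    refine hφ1 ?_
    have h0 : F (∑ p : s, φ (Pi.single p 1) • predualUnit p.1.1 p.1.2) = 0 := by
      refine hF _ ?_
      ext A
      have h1 : φ (e (J A)) = 0 := by
        have : φ (e (J A)) ∈ (LinearMap.range (e.comp J.toLinearMap)).map φ :=
          Submodule.mem_map_of_mem ⟨A, rfl⟩
        rwa [hφ2, Submodule.mem_bot] at this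
      rw [hφ] at h1
      simpa [predualMap_unit, map_sum, sum_apply] using h1
    rw [hφ]
    simpa [hTF, map_sum] using h0
  obtain ⟨T, rfl⟩ := hTX
  refine ⟨T, by rwa [J.norm_map] at hT, fun a => ?_⟩
  have h1 := hasSum_dual_l1 F a
  have h2 : HasSum _ (predualMap J a T) :=
    hasSum_dual_l1 ((ContinuousLinearMap.apply ℂ ℂ T).comp (predualMap J)) a
  refine h1.unique ?_
  convert h2 using 1
  funext s
  congr 1
  have h3 : F (l1Unit s) = F (predualUnit (unitVec s.1) (unitVec s.2)) :=
    hF' _ _ (by rw [predualMap_unit, predualMap, l1Lift_unit])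
  rw [h3, ← hTF]
  simp [predualMap, l1Lift_unit]

theorem isClosed_range_predualMap [CompleteSpace H] {J : X →ₗᵢ[ℂ] (H →L[ℂ] H)}
    (hJ : IsClosed {T : H →WOT[ℂ] H | T.toCLM ∈ Set.range J}) :
    IsClosed (Set.range (predualMap J)) :=
  isClosed_range_of_forall_dual _ (exists_of_vanish_ker hJ)

/-- The Krein-Smulian theorem for functionals: a bounded functional that is continuous on the unit
ball for the weak operator topology belongs to the predual. -/
theorem mem_range_predualMap [CompleteSpace H] {J : X →ₗᵢ[ℂ] (H →L[ℂ] H)}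
    (hJ : IsClosed {T : H →WOT[ℂ] H | T.toCLM ∈ Set.range J}) (g : StrongDual ℂ X)
    (hg : ∀ T : Finset (H × H) → X, (∀ s, ‖T s‖ ≤ 1) →
      (∀ x y, Filter.Tendsto (fun s => ⟪y, J (T s) x⟫_ℂ) Filter.atTop (𝓝 0)) →
      Filter.Tendsto (fun s => g (T s)) Filter.atTop (𝓝 0)) :
    g ∈ Set.range (predualMap J) := by
  rw [← (isClosed_range_predualMap hJ).closure_eq, Metric.mem_closure_iff]
  intro ε hε
  -- Otherwise each finite set `s` of pairs has a counterexample `T s`. These form a net in the unit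
  -- ball that tends weakly to `0`, although `g` stays away from `0` on it.
  obtain ⟨s, hs⟩ : ∃ s : Finset (H × H), ∀ T : X, ‖T‖ ≤ 1 →
      (∀ p ∈ s, ⟪p.2, J T p.1⟫_ℂ = 0) → ‖g T‖ ≤ ε / 2 := by
    by_contra! hcon
    choose T hT1 hT2 hT3 using hcon
    have h := hg T hT1 fun x y => by
      refine tendsto_const_nhds.congr' ?_
      filter_upwards [Filter.eventually_ge_atTop {(x, y)}] with s hs
      exact (hT2 s (x, y) (hs (Finset.mem_singleton_self _))).symm
    obtain ⟨s, hs⟩ := (h.norm.eventually_lt_const (u := ε / 2) (by simpa using hε)).exists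
    exact (hT3 s).not_gt hs
  let W : Submodule ℂ X := ⨅ p : s, (vecFunctional J p.1.1 p.1.2).toLinearMap.ker
  have hW : ∀ T : X, T ∈ W ↔ ∀ p ∈ s, ⟪p.2, J T p.1⟫_ℂ = 0 := fun T => by
    simp only [W, Submodule.mem_iInf, Subtype.forall]
    rfl
  have hnorm : ‖g.comp W.subtypeL‖ ≤ ε / 2 :=
    ContinuousLinearMap.opNorm_le_of_unit_norm (by positivity) fun T hT =>
      hs T (by simpa using hT.le) ((hW T).1 T.2)
  -- By Hahn-Banach, `g1` agrees with `g` on `W` and is small. Then `g - g1` vanishes on `W`, hence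
  -- is a finite combination of vector functionals, at distance `‖g1‖ < ε` from `g`.
  obtain ⟨g1, hg1, hg1n⟩ := exists_extension_norm_eq W (g.comp W.subtypeL)
  have hspan : (g - g1).toLinearMap ∈
      Submodule.span ℂ (Set.range fun p : s => (vecFunctional J p.1.1 p.1.2).toLinearMap) := by
    refine mem_span_of_iInf_ker_le_ker fun T hT => ?_
    have h1 := hg1 ⟨T, hT⟩
    rw [LinearMap.mem_ker]
    change g T - g1 T = 0
    rw [h1]
    exact sub_self _
  obtain ⟨c, hc⟩ := (Submodule.mem_span_range_iff_exists_fun ℂ).1 hspan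
  refine ⟨_, ⟨∑ p, c p • predualUnit p.1.1 p.1.2, rfl⟩, ?_⟩
  have hb : predualMap J (∑ p, c p • predualUnit p.1.1 p.1.2) = g - g1 := by
    ext T
    have h1 := LinearMap.congr_fun hc T
    simpa [map_sum, sum_apply, predualMap_unit] using h1
  rw [hb, dist_eq_norm, sub_sub_cancel, hg1n]
  linarith

theorem predualMap_apply_eq_tsum (J : X →ₗᵢ[ℂ] (H →L[ℂ] H)) (a : lp (fun _ : H × H => ℂ) 1)
    (T : X) : predualMap J a T = ∑' s, a s * ⟪unitVec s.2, J T (unitVec s.1)⟫_ℂ :=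
  ((summable_l1_smul _ (norm_vecFunctional_unitVec_le J) a).hasSum.mapL
    (ContinuousLinearMap.apply ℂ ℂ T)).tsum_eq.symm

omit [InnerProductSpace ℂ H] in
/-- A family on a countable type, reindexed by the natural numbers. -/
theorem memℓp_extend_encode {K : Type*} [Encodable K] (f : K → H) (b : K → ℝ) (hb : Summable b)
    (hf : ∀ k, ‖f k‖ ^ 2 ≤ b k) : Memℓp (Function.extend (Encodable.encode (α := K)) f 0) 2 := by
  refine memℓp_gen ?_
  have h1 : (fun n => ‖Function.extend (Encodable.encode (α := K)) f 0 n‖ ^ (2 : ℝ≥0∞).toReal) =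
      Function.extend (Encodable.encode (α := K)) (fun k => ‖f k‖ ^ 2) 0 := by
    funext n
    by_cases h : ∃ k, Encodable.encode (α := K) k = n
    · obtain ⟨k, rfl⟩ := h
      rw [Encodable.encode_injective.extend_apply, Encodable.encode_injective.extend_apply]
      simp
    · rw [Function.extend_apply' _ _ _ h, Function.extend_apply' _ _ _ h]
      simp
  rw [h1, summable_extend_zero Encodable.encode_injective]
  exact Summable.of_nonneg_of_le (fun k => by positivity) hf hb

/-- An `ℓ¹` family has countable support, and each coefficient splits into two factors of modulus
`√‖a s‖`, which are square summable. This turns `ℓ¹(H × H)` into the pairs of sequences that define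
the w*-topology. -/
theorem exists_lp_of_predualMap (J : X →ₗᵢ[ℂ] (H →L[ℂ] H)) (a : lp (fun _ : H × H => ℂ) 1) :
    ∃ x y : lp (fun _ : ℕ => H) 2, ∀ T, predualMap J a T = ∑' n, ⟪y n, J T (x n)⟫_ℂ := by
  let K : Set (H × H) := Function.support fun s => ‖a s‖
  have hK : K.Countable := (summable_norm_l1 a).countable_support
  have : Countable K := hK.to_subtype
  let _ : Encodable K := Encodable.ofCountable K
  let f : K → H := fun s => ((Real.sqrt ‖a s‖ : ℝ) : ℂ) • unitVec s.1.1
  let h : K → H := fun s => ((starRingEnd ℂ) (a s / (Real.sqrt ‖a s‖ : ℝ))) • unitVec s.1.2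
  have hb : Summable fun s : K => ‖a s‖ := (summable_norm_l1 a).subtype K
  have hf : ∀ s, ‖f s‖ ^ 2 ≤ ‖a s‖ := fun s => by
    have h1 : ‖f s‖ ≤ Real.sqrt ‖a s‖ := by
      rw [norm_smul, Complex.norm_real, Real.norm_of_nonneg (Real.sqrt_nonneg _)]
      exact mul_le_of_le_one_right (Real.sqrt_nonneg _) (norm_unitVec_le _)
    calc ‖f s‖ ^ 2 ≤ Real.sqrt ‖a s‖ ^ 2 := by gcongr
      _ = _ := Real.sq_sqrt (norm_nonneg _)
  have hh : ∀ s, ‖h s‖ ^ 2 ≤ ‖a s‖ := fun s => by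
    have h1 : ‖h s‖ ≤ Real.sqrt ‖a s‖ := by
      rw [norm_smul, RCLike.norm_conj, norm_div, Complex.norm_real,
        Real.norm_of_nonneg (Real.sqrt_nonneg _), Real.div_sqrt]
      exact mul_le_of_le_one_right (Real.sqrt_nonneg _) (norm_unitVec_le _)
    calc ‖h s‖ ^ 2 ≤ Real.sqrt ‖a s‖ ^ 2 := by gcongr
      _ = _ := Real.sq_sqrt (norm_nonneg _)
  refine ⟨⟨_, memℓp_extend_encode f _ hb hf⟩, ⟨_, memℓp_extend_encode h _ hb hh⟩, fun T => ?_⟩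
  have h1 : (fun n => ⟪Function.extend (Encodable.encode (α := K)) h 0 n,
      J T (Function.extend (Encodable.encode (α := K)) f 0 n)⟫_ℂ) =
      Function.extend (Encodable.encode (α := K))
        (fun s => a s * ⟪unitVec s.1.2, J T (unitVec s.1.1)⟫_ℂ) 0 := by
    funext n
    by_cases hn : ∃ k, Encodable.encode (α := K) k = n
    · obtain ⟨s, rfl⟩ := hn
      simp only [Encodable.encode_injective.extend_apply]
      have hs : ((Real.sqrt ‖a s‖ : ℝ) : ℂ) ≠ 0 := by
        rw [Complex.ofReal_ne_zero]
        exact (Real.sqrt_pos.2 (lt_of_le_of_ne (norm_nonneg _) (Ne.symm s.2))).ne'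
      simp only [f, h, map_smul, inner_smul_left, inner_smul_right, Complex.conj_conj]
      field_simp
    · simp only [Function.extend_apply' _ _ _ hn]
      simp
  change _ = ∑' n, ⟪Function.extend (Encodable.encode (α := K)) h 0 n,
      J T (Function.extend (Encodable.encode (α := K)) f 0 n)⟫_ℂ
  rw [h1, tsum_extend_zero Encodable.encode_injective, predualMap_apply_eq_tsum]
  refine (tsum_subtype_eq_of_support_subset ?_).symm
  intro s hs
  simp only [Function.mem_support, ne_eq, mul_eq_zero, not_or] at hs
  simpa [K] using hs.1

/-! ### Limits in the weak operator topology -/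

/-- Weak operator compactness of balls: the scalars `⟪y, T i x⟫` converge by compactness of discs,
and their limits form a bounded sesquilinear form. -/
theorem exists_wot_limit [CompleteSpace H] {ι : Type*} (U : Ultrafilter ι) (T : ι → H →L[ℂ] H)
    (C : ℝ) (hC : 0 ≤ C) (hT : ∀ i, ‖T i‖ ≤ C) :
    ∃ T₀ : H →L[ℂ] H, ∀ x y, Filter.Tendsto (fun i => ⟪y, T i x⟫_ℂ) U (𝓝 ⟪y, T₀ x⟫_ℂ) := by
  have hbound : ∀ x y i, ‖⟪y, T i x⟫_ℂ‖ ≤ C * ‖x‖ * ‖y‖ := fun x y i => by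
    calc _ ≤ ‖y‖ * ‖T i x‖ := norm_inner_le_norm _ _
      _ ≤ ‖y‖ * (C * ‖x‖) := by gcongr; exact (T i).le_of_opNorm_le (hT i) x
      _ = _ := by ring
  have hlim : ∀ x y, ∃ z, Filter.Tendsto (fun i => ⟪y, T i x⟫_ℂ) U (𝓝 z) := fun x y => by
    obtain ⟨z, -, hz⟩ := (isCompact_closedBall (0 : ℂ) (C * ‖x‖ * ‖y‖)).ultrafilter_le_nhds
      (U.map fun i => ⟪y, T i x⟫_ℂ) (by
        rw [Filter.le_principal_iff]
        exact Filter.Eventually.of_forall (f := (U : Filter ι)) fun i => by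
          simpa using hbound x y i)
    exact ⟨z, hz⟩
  choose f hf using hlim
  obtain ⟨T₀, -, h⟩ := exists_clm_of_form f C hC
    (fun x x' y => tendsto_nhds_unique (hf _ _) (by
      simpa only [map_add, inner_add_right] using (hf x y).add (hf x' y)))
    (fun c x y => tendsto_nhds_unique (hf _ _) (by
      simpa only [map_smul, inner_smul_right] using (hf x y).const_mul c))
    (fun x y y' => tendsto_nhds_unique (hf _ _) (by
      simpa only [inner_add_left] using (hf x y).add (hf x y')))
    (fun c x y => tendsto_nhds_unique (hf _ _) (by
      simpa only [inner_smul_left] using (hf x y).const_mul _))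
    (fun x y => le_of_tendsto (hf x y).norm (Filter.Eventually.of_forall (hbound x y)))
  exact ⟨T₀, fun x y => by rw [h]; exact hf x y⟩

theorem mem_wotClosure_of_tendsto {S : NonUnitalSubalgebra ℂ (H →L[ℂ] H)} [CompleteSpace H]
    {ι : Type*} {l : Filter ι} [l.NeBot] {T : ι → H →L[ℂ] H} {T₀ : H →L[ℂ] H}
    (hT : ∀ i, T i ∈ wotClosure S)
    (h : ∀ x y, Filter.Tendsto (fun i => ⟪y, T i x⟫_ℂ) l (𝓝 ⟪y, T₀ x⟫_ℂ)) : T₀ ∈ wotClosure S := by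
  have hc : IsClosed (closure ((ContinuousLinearMapWOT.ofCLM : (H →L[ℂ] H) → H →WOT[ℂ] H) ''
    (S : Set (H →L[ℂ] H)))) := isClosed_closure
  have ht : Filter.Tendsto (fun i => (ContinuousLinearMapWOT.ofCLM (T i) : H →WOT[ℂ] H)) l
      (𝓝 (ContinuousLinearMapWOT.ofCLM T₀)) := by
    rw [ContinuousLinearMapWOT.tendsto_iff_forall_inner_apply_tendsto]
    exact h
  exact hc.mem_of_tendsto ht (Filter.Eventually.of_forall hT)

end Predual

/-! ### Coordinates -/

theorem inner_basisVec {ι : Type*} (i : ι) (f : L2 ι) : ⟪basisVec i, f⟫_ℂ = f i := by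
  classical
  rw [basisVec, lp.inner_single_left]
  simp

theorem continuous_wot_inner {H : Type*} [NormedAddCommGroup H] [InnerProductSpace ℂ H] (x y : H) :
    Continuous fun T : H →WOT[ℂ] H => ⟪y, T.toCLM x⟫_ℂ :=
  ContinuousLinearMapWOT.continuous_dual_apply x (innerSL ℂ y)

theorem continuous_wot_coord {ι : Type*} (f : L2 ι) (i : ι) :
    Continuous fun T : L2 ι →WOT[ℂ] L2 ι => (T.toCLM f) i := by
  simpa only [inner_basisVec] using continuous_wot_inner f (basisVec i)

variable {V : Type u} [Quiver.{v} V]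

theorem creation_apply_prepend {x a b : V} (e : a ⟶ b) (w : Quiver.Path x a)
    (f : L2 (PathSpace V)) : creation e f (PathSpace.prepend e w) = f ⟨x, a, w⟩ := by
  rw [creation, pullOp_apply, (stripEdge_eq_some e _ ⟨x, a, w⟩).2 ⟨x, w, rfl, rfl⟩]
  rfl

theorem creation_apply_vertex {a b : V} (e : a ⟶ b) (y : V) (f : L2 (PathSpace V)) :
    creation e f (PathSpace.vertex y) = 0 := rfl

theorem creation_apply_prepend_of_ne {x a b a' b' : V} (e' : a' ⟶ b') (e : a ⟶ b)
    (w : Quiver.Path x a) (f : L2 (PathSpace V))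
    (h : (⟨a, b, e⟩ : Σ c d : V, (c ⟶ d)) ≠ ⟨a', b', e'⟩) :
    creation e' f (PathSpace.prepend e w) = 0 := by
  rw [creation, pullOp_apply, PathSpace.prepend, stripEdge, if_neg h]
  rfl

theorem vertexProj_apply [DecidableEq V] (y : V) (f : L2 (PathSpace V)) (u : PathSpace V) :
    vertexProj y f u = if u.range = y then f u else 0 := by
  rw [vertexProj, pullOp_apply]
  by_cases h : u.range = y <;> simp [h]

/-- The adjoint of the operator `L_e`. -/
def annihilation {a b : V} (e : a ⟶ b) : L2 (PathSpace V) →L[ℂ] L2 (PathSpace V) :=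
  ContinuousLinearMap.adjoint (creation e)

theorem annihilation_apply {x a b : V} (e : a ⟶ b) (w : Quiver.Path x a)
    (f : L2 (PathSpace V)) : annihilation e f ⟨x, a, w⟩ = f (PathSpace.prepend e w) := by
  rw [← inner_basisVec, annihilation, ContinuousLinearMap.adjoint_inner_right, creation_basisVec,
    inner_basisVec]

theorem annihilation_apply_of_ne {a b : V} (e : a ⟶ b) (u : PathSpace V) (h : u.range ≠ a)
    (f : L2 (PathSpace V)) : annihilation e f u = 0 := by
  rw [← inner_basisVec, annihilation, ContinuousLinearMap.adjoint_inner_right,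
    creation_basisVec_of_ne e u h, inner_zero_left]

/-- The adjoint of `L_e` reads only the coordinates at paths of the form `e w`. -/
theorem annihilation_mul_ext {a b : V} (e : a ⟶ b)
    {A B : L2 (PathSpace V) →L[ℂ] L2 (PathSpace V)}
    (h : ∀ (f : L2 (PathSpace V)) (x : V) (w : Quiver.Path x a),
      A f (PathSpace.prepend e w) = B f (PathSpace.prepend e w)) :
    annihilation e * A = annihilation e * B := by
  ext f u
  change annihilation e (A f) u = annihilation e (B f) u
  obtain ⟨x, c, w⟩ := u
  by_cases hc : c = a
  · subst hc
    rw [annihilation_apply, annihilation_apply, h]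
  · rw [annihilation_apply_of_ne e _ hc, annihilation_apply_of_ne e _ hc]

theorem annihilation_mul_vertexProj {a b : V} (e : a ⟶ b) :
    annihilation e * vertexProj b = annihilation e := by
  classical
  rw [← mul_one (annihilation e), mul_assoc]
  refine annihilation_mul_ext e fun f x w => ?_
  simp [vertexProj_apply, PathSpace.prepend]

theorem annihilation_mul_vertexProj_of_ne {a b z : V} (e : a ⟶ b) (h : z ≠ b) :
    annihilation e * vertexProj z = 0 := by
  classical
  rw [← mul_zero (annihilation e)]
  refine annihilation_mul_ext e fun f x w => ?_
  simp [vertexProj_apply, PathSpace.prepend, h.symm]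

theorem annihilation_mul_creation {a b : V} (e : a ⟶ b) :
    annihilation e * creation e = vertexProj a := by
  classical
  ext f u
  change annihilation e (creation e f) u = vertexProj a f u
  obtain ⟨x, c, w⟩ := u
  rw [vertexProj_apply]
  by_cases hc : c = a
  · subst hc
    rw [annihilation_apply, creation_apply_prepend, if_pos rfl]
  · rw [annihilation_apply_of_ne e _ hc, if_neg hc]

theorem annihilation_mul_creation_of_ne {a b a' b' : V} (e : a ⟶ b) (e' : a' ⟶ b')
    (h : (⟨a, b, e⟩ : Σ c d : V, (c ⟶ d)) ≠ ⟨a', b', e'⟩) :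
    annihilation e * creation e' = 0 := by
  rw [← mul_zero (annihilation e)]
  refine annihilation_mul_ext e fun f x w => ?_
  rw [creation_apply_prepend_of_ne e' e w f h]
  rfl

/-! ### The coefficient at a vertex -/

/-- The Fourier coefficient of an operator at the vertex `y`. -/
def vertexCoeff (y : V) :
    (L2 (PathSpace V) →L[ℂ] L2 (PathSpace V)) →ₗ[ℂ] ℂ where
  toFun B := B (basisVec (PathSpace.vertex y)) (PathSpace.vertex y)
  map_add' _ _ := rfl
  map_smul' _ _ := rfl

theorem vertexCoeff_apply (y : V) (B : L2 (PathSpace V) →L[ℂ] L2 (PathSpace V)) :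
    vertexCoeff y B = B (basisVec (PathSpace.vertex y)) (PathSpace.vertex y) := rfl

theorem norm_basisVec {ι : Type*} (i : ι) : ‖(basisVec i : L2 ι)‖ = 1 := by
  classical
  rw [basisVec, lp.norm_single (by norm_num)]
  simp

theorem norm_coord_le {ι : Type*} (B : L2 ι →L[ℂ] L2 ι) (f : L2 ι) (i : ι) :
    ‖B f i‖ ≤ ‖B‖ * ‖f‖ :=
  (lp.norm_apply_le_norm (by norm_num) (B f) i).trans (B.le_opNorm f)

theorem norm_vertexCoeff_le (y : V) (B : L2 (PathSpace V) →L[ℂ] L2 (PathSpace V)) :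
    ‖vertexCoeff y B‖ ≤ ‖B‖ := by
  rw [vertexCoeff_apply]
  simpa [norm_basisVec] using norm_coord_le B (basisVec (PathSpace.vertex y)) (PathSpace.vertex y)

variable (V) in
/-- The operators whose adjoints have all `ξ_y`, `y` a vertex, as eigenvectors. -/
def vertexEigenAlgebra :
    NonUnitalSubalgebra ℂ (L2 (PathSpace V) →L[ℂ] L2 (PathSpace V)) where
  carrier := {B | ∀ (y : V) (f : L2 (PathSpace V)),
    B f (PathSpace.vertex y) = vertexCoeff y B * f (PathSpace.vertex y)}
  zero_mem' y f := by simp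
  add_mem' {A B} hA hB y f := by
    rw [map_add, add_mul, ← hA, ← hB]
    rfl
  smul_mem' c A hA y f := by
    rw [map_smul, smul_mul_assoc, ← hA]
    rfl
  mul_mem' {A B} hA hB y f := by
    change A (B f) _ = A (B _) _ * _
    rw [hA, hB, hA, hB y (basisVec _), vertexCoeff_apply y B]
    simp [basisVec]
    ring

theorem vertexCoeff_mul (y : V) {A : L2 (PathSpace V) →L[ℂ] L2 (PathSpace V)}
    (hA : A ∈ vertexEigenAlgebra V) (B : L2 (PathSpace V) →L[ℂ] L2 (PathSpace V)) :
    vertexCoeff y (A * B) = vertexCoeff y A * vertexCoeff y B :=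
  hA y _

theorem vertexCoeff_creation (y : V) {a b : V} (e : a ⟶ b) : vertexCoeff y (creation e) = 0 := rfl

theorem vertexCoeff_vertexProj (y z : V) [DecidableEq V] :
    vertexCoeff y (vertexProj z) = if y = z then 1 else 0 := by
  rw [vertexCoeff_apply, vertexProj_apply]
  simp [PathSpace.vertex, basisVec]

/-- An induction principle for the free semigroupoid algebra. -/
theorem freeSemigroupoidAlgebra_le
    {C : NonUnitalSubalgebra ℂ (L2 (PathSpace V) →L[ℂ] L2 (PathSpace V))}
    (hC : IsClosed {T : L2 (PathSpace V) →WOT[ℂ] L2 (PathSpace V) | T.toCLM ∈ C})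
    (hL : ∀ (a b : V) (e : a ⟶ b), creation e ∈ C) (hP : ∀ x : V, vertexProj x ∈ C)
    {T : L2 (PathSpace V) →L[ℂ] L2 (PathSpace V)} (hT : T ∈ freeSemigroupoidAlgebra V) :
    T ∈ C := by
  have h1 : tensorAlgebra V ≤ C := by
    refine NonUnitalSubalgebra.topologicalClosure_minimal ?_
      (hC.preimage ContinuousLinearMapWOT.continuous_ofCLM)
    rw [NonUnitalAlgebra.adjoin_le_iff]
    rintro _ (⟨a, b, e, rfl⟩ | ⟨x, rfl⟩)
    exacts [hL a b e, hP x]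
  have h2 := closure_minimal (s := ContinuousLinearMapWOT.ofCLM ''
    (tensorAlgebra V : Set (L2 (PathSpace V) →L[ℂ] L2 (PathSpace V)))) (by
      rintro _ ⟨A, hA, rfl⟩
      exact h1 hA) hC
  exact h2 hT

theorem isClosed_wot_freeSemigroupoidAlgebra :
    IsClosed {T : L2 (PathSpace V) →WOT[ℂ] L2 (PathSpace V) |
      T.toCLM ∈ freeSemigroupoidAlgebra V} :=
  isClosed_closure

/-- At a vertex coordinate, `L_e` gives `0` and `P_x` multiplies by `0` or `1`; the eigenvector
relation survives weak limits. Hence each `vertexCoeff y` is multiplicative on the free semigroupoid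
algebra. -/
theorem mem_vertexEigenAlgebra {T : L2 (PathSpace V) →L[ℂ] L2 (PathSpace V)}
    (hT : T ∈ freeSemigroupoidAlgebra V) : T ∈ vertexEigenAlgebra V := by
  classical
  refine freeSemigroupoidAlgebra_le ?_ (fun a b e y f => ?_) (fun x y f => ?_) hT
  · change IsClosed {T : L2 (PathSpace V) →WOT[ℂ] L2 (PathSpace V) | ∀ (y : V) f,
      T.toCLM f (PathSpace.vertex y) = vertexCoeff y T.toCLM * f (PathSpace.vertex y)}
    simp only [Set.ofPred_forall]
    refine isClosed_iInter fun y => isClosed_iInter fun f => isClosed_eq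
      (continuous_wot_coord _ _) ((continuous_wot_coord _ _).mul continuous_const)
  · rw [vertexCoeff_creation, zero_mul, creation_apply_vertex]
  · rw [vertexCoeff_vertexProj, vertexProj_apply, ite_mul, one_mul, zero_mul]
    rfl

theorem creation_mem {a b : V} (e : a ⟶ b) : creation e ∈ freeSemigroupoidAlgebra V :=
  subset_closure ⟨_, NonUnitalSubalgebra.le_topologicalClosure _
    (NonUnitalAlgebra.subset_adjoin ℂ (Or.inl ⟨a, b, e, rfl⟩)), rfl⟩

theorem vertexProj_mem (x : V) : vertexProj x ∈ freeSemigroupoidAlgebra V :=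
  subset_closure ⟨_, vertexProj_mem_tensorAlgebra x, rfl⟩

/-! ### Division by an edge -/

/-- The quotient `B_e` in the expansion `P_b B = φ_b(B) P_b + ∑ L_e B_e`, where `e` runs through
the edges with range `b`. -/
def edgeQuotient {a b : V} (e : a ⟶ b) :
    (L2 (PathSpace V) →L[ℂ] L2 (PathSpace V)) →ₗ[ℂ] L2 (PathSpace V) →L[ℂ] L2 (PathSpace V) where
  toFun B := annihilation e * (B - vertexCoeff b B • vertexProj b)
  map_add' A B := by rw [map_add, ← mul_add, add_smul]; congr 1; abel
  map_smul' c A := by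
    rw [map_smul, smul_eq_mul, mul_smul, ← smul_sub, mul_smul_comm]
    rfl

theorem edgeQuotient_apply {a b : V} (e : a ⟶ b)
    (B : L2 (PathSpace V) →L[ℂ] L2 (PathSpace V)) :
    edgeQuotient e B = annihilation e * (B - vertexCoeff b B • vertexProj b) := rfl

theorem edgeQuotient_eq {a b : V} (e : a ⟶ b)
    (B : L2 (PathSpace V) →L[ℂ] L2 (PathSpace V)) :
    edgeQuotient e B = annihilation e * B - vertexCoeff b B • annihilation e := by
  rw [edgeQuotient_apply, mul_sub, mul_smul_comm, annihilation_mul_vertexProj]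

theorem edgeQuotient_apply_coord {x a b : V} (e : a ⟶ b)
    (B : L2 (PathSpace V) →L[ℂ] L2 (PathSpace V)) (f : L2 (PathSpace V)) (w : Quiver.Path x a) :
    edgeQuotient e B f ⟨x, a, w⟩ =
      B f (PathSpace.prepend e w) - vertexCoeff b B * f (PathSpace.prepend e w) := by
  rw [edgeQuotient_eq]
  change annihilation e (B f) _ - vertexCoeff b B * annihilation e f _ = _
  rw [annihilation_apply, annihilation_apply]

theorem norm_edgeQuotient_le {a b : V} (e : a ⟶ b)
    (B : L2 (PathSpace V) →L[ℂ] L2 (PathSpace V)) :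
    ‖edgeQuotient e B‖ ≤ 2 * ‖(annihilation e : L2 (PathSpace V) →L[ℂ] _)‖ * ‖B‖ := by
  rw [edgeQuotient_eq]
  calc _ ≤ ‖annihilation e * B‖ + ‖vertexCoeff b B • annihilation e‖ := norm_sub_le _ _
    _ ≤ ‖annihilation e‖ * ‖B‖ + ‖B‖ * ‖annihilation e‖ := by
      rw [norm_smul]
      gcongr
      · exact norm_mul_le _ _
      · exact norm_vertexCoeff_le _ _
    _ = _ := by ring

/-- A twisted derivation rule. It makes membership of the quotient in the algebra stable under
products, as `edgeQuotient_mem` requires. -/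
theorem edgeQuotient_mul {a b : V} (e : a ⟶ b)
    {A : L2 (PathSpace V) →L[ℂ] L2 (PathSpace V)} (hA : A ∈ vertexEigenAlgebra V)
    (B : L2 (PathSpace V) →L[ℂ] L2 (PathSpace V)) :
    edgeQuotient e (A * B) = edgeQuotient e A * B + vertexCoeff b A • edgeQuotient e B := by
  simp only [edgeQuotient_eq, vertexCoeff_mul b hA, sub_mul, smul_sub, smul_smul, mul_assoc,
    smul_mul_assoc]
  abel

/-- On generators the quotient is `0` or a vertex projection: subtracting `φ_b(B) P_b` removes the
term `L_e^*` that `P_b` would otherwise produce. The product rule and weak operator continuity of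
the quotient do the rest. -/
theorem edgeQuotient_mem {a b : V} (e : a ⟶ b) {B : L2 (PathSpace V) →L[ℂ] L2 (PathSpace V)}
    (hB : B ∈ freeSemigroupoidAlgebra V) : edgeQuotient e B ∈ freeSemigroupoidAlgebra V := by
  classical
  let C : NonUnitalSubalgebra ℂ (L2 (PathSpace V) →L[ℂ] L2 (PathSpace V)) :=
    { carrier := {B | B ∈ freeSemigroupoidAlgebra V ∧
        edgeQuotient e B ∈ freeSemigroupoidAlgebra V}
      zero_mem' := ⟨zero_mem _, by rw [map_zero]; exact zero_mem _⟩
      add_mem' := fun hA hB => ⟨add_mem hA.1 hB.1, by rw [map_add]; exact add_mem hA.2 hB.2⟩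
      smul_mem' := fun c A hA => ⟨Subalgebra.smul_mem _ hA.1 c, by
        rw [map_smul]; exact Subalgebra.smul_mem _ hA.2 c⟩
      mul_mem' := fun {A B} hA hB => ⟨mul_mem hA.1 hB.1, by
        rw [edgeQuotient_mul e (mem_vertexEigenAlgebra hA.1)]
        exact add_mem (mul_mem hA.2 hB.1) (Subalgebra.smul_mem _ hB.2 _)⟩ }
  have hcont : Continuous fun T : L2 (PathSpace V) →WOT[ℂ] L2 (PathSpace V) =>
      (ContinuousLinearMapWOT.ofCLM (edgeQuotient e T.toCLM) :
        L2 (PathSpace V) →WOT[ℂ] L2 (PathSpace V)) := by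
    have h1 := wot_continuous_mul_left (ContinuousLinearMapWOT.ofCLM
      (annihilation e) : L2 (PathSpace V) →WOT[ℂ] L2 (PathSpace V))
    have h2 : Continuous fun T : L2 (PathSpace V) →WOT[ℂ] L2 (PathSpace V) =>
        vertexCoeff b T.toCLM := continuous_wot_coord _ _
    have h3 := h1.sub (h2.smul (continuous_const (y := (ContinuousLinearMapWOT.ofCLM
      (annihilation e) : L2 (PathSpace V) →WOT[ℂ] L2 (PathSpace V)))))
    refine h3.congr fun T => ?_
    rw [edgeQuotient_eq]
    rfl
  refine (freeSemigroupoidAlgebra_le (C := C) ?_ ?_ ?_ hB).2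
  · exact isClosed_wot_freeSemigroupoidAlgebra.inter
      (isClosed_wot_freeSemigroupoidAlgebra.preimage hcont)
  · intro a' b' e'
    refine ⟨creation_mem e', ?_⟩
    rw [edgeQuotient_eq, vertexCoeff_creation, zero_smul, sub_zero]
    by_cases h : (⟨a, b, e⟩ : Σ c d : V, (c ⟶ d)) = ⟨a', b', e'⟩
    · cases h
      rw [annihilation_mul_creation]
      exact vertexProj_mem _
    · rw [annihilation_mul_creation_of_ne e e' h]
      exact zero_mem _
  · intro z
    refine ⟨vertexProj_mem z, ?_⟩
    rw [edgeQuotient_eq, vertexCoeff_vertexProj]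
    by_cases h : b = z
    · subst h
      rw [annihilation_mul_vertexProj, if_pos rfl, one_smul, sub_self]
      exact zero_mem _
    · rw [annihilation_mul_vertexProj_of_ne e (Ne.symm h), if_neg h, zero_smul, sub_zero]
      exact zero_mem _

/-- The expansion of `P_y B` along the edges with range `y`. -/
theorem vertexProj_mul_eq (y : V) [Fintype (Quiver.Costar y)]
    {B : L2 (PathSpace V) →L[ℂ] L2 (PathSpace V)} (hB : B ∈ vertexEigenAlgebra V) :
    vertexProj y * B = vertexCoeff y B • vertexProj y +
      ∑ e : Quiver.Costar y, creation e.2 * edgeQuotient e.2 B := by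
  classical
  ext f u
  change vertexProj y (B f) u = vertexCoeff y B * vertexProj y f u +
    (∑ e : Quiver.Costar y, creation e.2 * edgeQuotient e.2 B) f u
  have hsum : (∑ e : Quiver.Costar y, creation e.2 * edgeQuotient e.2 B) f u =
      ∑ e : Quiver.Costar y, creation e.2 (edgeQuotient e.2 B f) u := by
    rw [← inner_basisVec, sum_apply, inner_sum]
    simp only [inner_basisVec, mul_apply_eq_comp]
  rw [hsum, vertexProj_apply, vertexProj_apply]
  obtain ⟨x, d, p⟩ := u
  cases p with
  | nil =>
    have h0 : ∑ e : Quiver.Costar y,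
        creation e.2 (edgeQuotient e.2 B f) (⟨x, x, Quiver.Path.nil⟩ : PathSpace V) = 0 :=
      Finset.sum_eq_zero fun e _ => creation_apply_vertex e.2 x _
    rw [h0, add_zero, mul_ite, mul_zero]
    split_ifs with h
    · change x = y at h
      subst h
      exact hB x f
    · rfl
  | @cons c _ p e₀ =>
    by_cases h : d = y
    · subst h
      rw [if_pos rfl, if_pos rfl, Finset.sum_eq_single (⟨c, e₀⟩ : Quiver.Costar d)]
      · rw [show (⟨x, d, p.cons e₀⟩ : PathSpace V) = PathSpace.prepend e₀ p from rfl,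
          creation_apply_prepend, edgeQuotient_apply_coord]
        ring
      · rintro ⟨c', e'⟩ - hne
        refine creation_apply_prepend_of_ne e' e₀ p _ fun heq => hne ?_
        cases heq
        rfl
      · simp
    · rw [if_neg h, if_neg h, mul_zero, zero_add]
      refine (Finset.sum_eq_zero fun e _ => ?_).symm
      refine creation_apply_prepend_of_ne e.2 e₀ p _ fun heq => h ?_
      cases heq
      rfl

/-! ### Automatic norm continuity -/

theorem isClosed_freeSemigroupoidAlgebra :
    IsClosed (freeSemigroupoidAlgebra V : Set (L2 (PathSpace V) →L[ℂ] L2 (PathSpace V))) :=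
  isClosed_wot_freeSemigroupoidAlgebra.preimage ContinuousLinearMapWOT.continuous_ofCLM

instance : CompleteSpace (freeSemigroupoidAlgebra V) :=
  isClosed_freeSemigroupoidAlgebra.completeSpace_coe

/-- The operator `L_p` of a path `p`. -/
def pathCreation {a : V} : {b : V} → Quiver.Path a b → L2 (PathSpace V) →L[ℂ] L2 (PathSpace V)
  | _, .nil => vertexProj a
  | _, .cons p e => creation e * pathCreation p

theorem pathCreation_mem {a b : V} (p : Quiver.Path a b) :
    pathCreation p ∈ freeSemigroupoidAlgebra V := by
  induction p with
  | nil => exact vertexProj_mem a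
  | cons p e ih => exact mul_mem (creation_mem e) ih

theorem pathCreation_apply_comp {x a b : V} (w : Quiver.Path x a) (p : Quiver.Path a b)
    (f : L2 (PathSpace V)) : pathCreation p f ⟨x, b, w.comp p⟩ = f ⟨x, a, w⟩ := by
  classical
  induction p with
  | nil =>
    change vertexProj a f ⟨x, a, w⟩ = _
    rw [vertexProj_apply, if_pos rfl]
  | cons p e ih => exact (creation_apply_prepend e (w.comp p) _).trans ih

theorem pathCreation_vanish {a b : V} (p : Quiver.Path a b) {k : ℕ} {f : L2 (PathSpace V)}
    (hf : ∀ v : PathSpace V, v.path.length < k → f v = 0) (v : PathSpace V)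
    (hv : v.path.length < k + p.length) : pathCreation p f v = 0 := by
  classical
  induction p generalizing v with
  | nil =>
    change vertexProj a f v = 0
    rw [vertexProj_apply, hf v hv, ite_self]
  | cons p e ih =>
    change creation e (pathCreation p f) v = 0
    rw [creation, pullOp_apply]
    cases h : stripEdge e v with
    | none => rfl
    | some v' =>
      obtain ⟨x, q, rfl, rfl⟩ := (stripEdge_eq_some e v v').1 h
      refine ih _ ?_
      simp only [PathSpace.prepend, Quiver.Path.length_cons] at hv ⊢
      omega

/-- Each factor `L_p` raises the order of vanishing by `p.length ≥ 1`. -/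
theorem pathCreation_pow_vanish {a : V} (p : Quiver.Path a a) (hp : p.length ≠ 0) (m : ℕ)
    (f : L2 (PathSpace V)) (v : PathSpace V) (hv : v.path.length < m) :
    (pathCreation p ^ m) f v = 0 := by
  induction m generalizing v with
  | zero => omega
  | succ m ih =>
    rw [pow_succ']
    exact pathCreation_vanish p ih v (by omega)

/-- The path `p^n w`. -/
def pathPow {x a : V} (w : Quiver.Path x a) (p : Quiver.Path a a) : ℕ → Quiver.Path x a
  | 0 => w
  | n + 1 => (pathPow w p n).comp p

theorem pathCreation_pow_apply {x a : V} (w : Quiver.Path x a) (p : Quiver.Path a a) (n : ℕ)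
    (f : L2 (PathSpace V)) : (pathCreation p ^ n) f ⟨x, a, pathPow w p n⟩ = f ⟨x, a, w⟩ := by
  induction n with
  | zero => rfl
  | succ n ih =>
    rw [pow_succ']
    exact (pathCreation_apply_comp _ p _).trans ih

section NormContinuity

variable {A : Type*} [NormedRing A] [NormedAlgebra ℂ A] (τ : A ≃ₐ[ℂ] freeSemigroupoidAlgebra V)

/-- The functional `a ↦ (τ(a) f)(u)`. -/
def coordFunctional (f : L2 (PathSpace V)) (u : PathSpace V) : A →ₗ[ℂ] ℂ where
  toFun a := (τ a : L2 (PathSpace V) →L[ℂ] L2 (PathSpace V)) f u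
  map_add' a b := by rw [map_add]; rfl
  map_smul' c a := by rw [map_smul]; rfl

theorem coordFunctional_apply (f : L2 (PathSpace V)) (u : PathSpace V) (a : A) :
    coordFunctional τ f u a = (τ a : L2 (PathSpace V) →L[ℂ] L2 (PathSpace V)) f u := rfl

/-- Since `(L_e τ(c) f)(e w) = (τ(c) f)(w)`, the functional at `w` is the one at `e w` composed with
left multiplication by `τ⁻¹(L_e)`. Read contrapositively, discontinuity spreads along edges. -/
theorem continuous_coordFunctional_of_prepend {f : L2 (PathSpace V)} {x a b : V} (e : a ⟶ b)
    (w : Quiver.Path x a) (h : Continuous (coordFunctional τ f (PathSpace.prepend e w))) :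
    Continuous (coordFunctional τ f ⟨x, a, w⟩) := by
  have h1 := h.comp (continuous_const_mul (τ.symm ⟨creation e, creation_mem e⟩))
  refine h1.congr fun c => ?_
  rw [Function.comp_apply, coordFunctional_apply, map_mul, AlgEquiv.apply_symm_apply]
  exact creation_apply_prepend e w _

/-- The gliding hump runs along the paths `p^n w`, with left multiplication by `τ⁻¹(L_p)` as the
constant operator `t`. -/
theorem continuous_coordFunctional_of_cycle [CompleteSpace A] {f : L2 (PathSpace V)} {x a : V}
    (w : Quiver.Path x a) (p : Quiver.Path a a) (hp : p.length ≠ 0) :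
    Continuous (coordFunctional τ f ⟨x, a, w⟩) := by
  by_contra hd
  set T : freeSemigroupoidAlgebra V := ⟨pathCreation p, pathCreation_mem p⟩ with hT
  have hTpow : ∀ m : ℕ, ((T ^ m : freeSemigroupoidAlgebra V) :
      L2 (PathSpace V) →L[ℂ] L2 (PathSpace V)) = pathCreation p ^ m := fun m => by
    rw [SubmonoidClass.coe_pow]
  set g : ℕ → A →ₗ[ℂ] ℂ := fun m =>
    (coordFunctional τ f ⟨x, a, w⟩).comp (LinearMap.mulLeft ℂ (τ.symm T ^ m)) with hg
  have hgapply : ∀ m c, g m c = (pathCreation p ^ m)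
      ((τ c : L2 (PathSpace V) →L[ℂ] L2 (PathSpace V)) f) ⟨x, a, w⟩ := fun m c => by
    rw [hg, ← hTpow]
    change coordFunctional τ f ⟨x, a, w⟩ (τ.symm T ^ m * c) = _
    rw [coordFunctional_apply, map_mul, map_pow, AlgEquiv.apply_symm_apply]
    rfl
  -- For `m > w.length` the operator `L_p^m` leaves nothing at `w`, so `g m = 0`. As `g 0` is
  -- discontinuous, there is an `m` with `g m` discontinuous and `g (m + 1)` continuous.
  have hex : ∃ m, Continuous (g m) := ⟨w.length + 1, by
    refine continuous_const (y := (0 : ℂ)) |>.congr fun c => ?_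
    rw [hgapply]
    exact (pathCreation_pow_vanish p hp (w.length + 1) _ ⟨x, a, w⟩ (Nat.lt_succ_self _)).symm⟩
  classical
  have hpos : Nat.find hex ≠ 0 := fun h0 => by
    have h1 := Nat.find_spec hex
    rw [h0] at h1
    exact hd (h1.congr fun c => by rw [hgapply]; rfl)
  obtain ⟨m, hm⟩ := Nat.exists_eq_succ_of_ne_zero hpos
  have hc1 : Continuous (g (m + 1)) := by
    have h1 := Nat.find_spec hex
    rwa [hm] at h1
  have hd1 : ¬ Continuous (g m) := Nat.find_min hex (by omega)
  set t : A →L[ℂ] A := ContinuousLinearMap.mul ℂ A (τ.symm T) with ht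
  have htpow : ∀ n c, (t ^ n) c = τ.symm T ^ n * c := fun n c => by
    induction n with
    | zero => simp
    | succ n ih =>
      rw [pow_succ', pow_succ', mul_assoc, ← ih]
      rfl
  set F : ℕ → A →ₗ[ℂ] ℂ := fun n =>
    (coordFunctional τ f ⟨x, a, pathPow w p n⟩).comp (LinearMap.mulLeft ℂ (τ.symm T ^ m)) with hF
  have hFapply : ∀ n c, F n c = (pathCreation p ^ m)
      ((τ c : L2 (PathSpace V) →L[ℂ] L2 (PathSpace V)) f) ⟨x, a, pathPow w p n⟩ := fun n c => by
    rw [hF, ← hTpow]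
    change coordFunctional τ f ⟨x, a, pathPow w p n⟩ (τ.symm T ^ m * c) = _
    rw [coordFunctional_apply, map_mul, map_pow, AlgEquiv.apply_symm_apply]
    rfl
  have hτpow : ∀ k c, (τ ((t ^ k) c) : L2 (PathSpace V) →L[ℂ] L2 (PathSpace V)) f =
      (pathCreation p ^ k) ((τ c : L2 (PathSpace V) →L[ℂ] L2 (PathSpace V)) f) := fun k c => by
    rw [htpow, map_mul, map_pow, AlgEquiv.apply_symm_apply, ← hTpow]
    rfl
  -- Moving the coordinate to `p^n w` cancels `n` factors `L_p`. So `F n ∘ t^n = g m` and `F n ∘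
  -- t^(n+1) = g (m + 1)`, as the gliding hump requires.
  have hshift : ∀ n k c, F n ((t ^ (n + k)) c) = g (m + k) c := fun n k c => by
    rw [hFapply, hgapply, hτpow]
    change (pathCreation p ^ m * pathCreation p ^ (n + k)) _ _ = _
    rw [← pow_add, show m + (n + k) = n + (m + k) by ring, pow_add _ n]
    exact pathCreation_pow_apply w p n _
  refine gliding_hump (fun _ => t) (fun n => t ^ n) (pow_zero t) (fun n => pow_succ t n) F
    (fun c => ⟨‖(τ (τ.symm T ^ m * c) : L2 (PathSpace V) →L[ℂ] L2 (PathSpace V))‖ * ‖f‖,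
      fun n => ?_⟩) (fun n h => ?_) (fun n => ?_)
  · exact norm_coord_le (τ (τ.symm T ^ m * c) : L2 (PathSpace V) →L[ℂ] L2 (PathSpace V)) f _
  · exact hd1 (h.congr fun c => hshift n 0 c)
  · exact hc1.congr fun c => (hshift n 1 c).symm

/-- Here `t_n` is left multiplication by `1 - τ⁻¹(P_x)`, with `x` the range of `U n`. It kills the
coordinate at `U n` and, the ranges being distinct, leaves those at the other `U k` alone. -/
theorem not_injective_range [CompleteSpace A] {f : L2 (PathSpace V)} (U : ℕ → PathSpace V)
    (hU : ∀ n, ¬ Continuous (coordFunctional τ f (U n)))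
    (hinj : Function.Injective fun n => (U n).range) : False := by
  classical
  set q : ℕ → A := fun n => τ.symm ⟨vertexProj (U n).range, vertexProj_mem _⟩ with hq
  have hqa : ∀ k c n, coordFunctional τ f (U n) (q k * c) =
      if (U n).range = (U k).range then coordFunctional τ f (U n) c else 0 := fun k c n => by
    rw [coordFunctional_apply, hq, map_mul, AlgEquiv.apply_symm_apply]
    exact vertexProj_apply _ _ _
  set t : ℕ → A →L[ℂ] A := fun n => ContinuousLinearMap.mul ℂ A (1 - q n) with ht
  let w : ℕ → A →L[ℂ] A := fun n => Nat.rec 1 (fun n s => s * t n) n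
  have hw : ∀ n, w (n + 1) = w n * t n := fun n => rfl
  have hta : ∀ n k c, coordFunctional τ f (U n) (t k c) =
      if n = k then 0 else coordFunctional τ f (U n) c := fun n k c => by
    change coordFunctional τ f (U n) ((1 - q k) * c) = _
    rw [sub_mul, one_mul, map_sub, hqa]
    by_cases h : n = k
    · simp [h]
    · rw [if_neg h, if_neg fun h' => h (hinj h'), sub_zero]
  have hwa : ∀ n k c, k ≤ n → coordFunctional τ f (U n) (w k c) = coordFunctional τ f (U n) c := by
    intro n k
    induction k with
    | zero => intro c _; rfl
    | succ k ih =>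
      intro c hk
      rw [hw]
      change coordFunctional τ f (U n) (w k (t k c)) = _
      rw [ih _ (by omega), hta, if_neg (by omega)]
  refine gliding_hump t w rfl hw (fun n => coordFunctional τ f (U n)) (fun c =>
    ⟨‖(τ c : L2 (PathSpace V) →L[ℂ] L2 (PathSpace V))‖ * ‖f‖, fun n =>
      norm_coord_le (τ c : L2 (PathSpace V) →L[ℂ] L2 (PathSpace V)) f _⟩) (fun n h => ?_)
    (fun n => ?_)
  · exact hU n (h.congr fun c => hwa n n c le_rfl)
  · refine (continuous_const (y := (0 : ℂ))).congr fun c => ?_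
    rw [hw]
    change _ = coordFunctional τ f (U n) (w n (t n c))
    rw [hwa n n _ le_rfl, hta, if_pos rfl]

/-- Prepending edges forever gives paths `U n` with discontinuous functionals. A repeated range
would give a cycle, so the ranges are distinct; each alternative has been excluded. -/
theorem continuous_coordFunctional [CompleteSpace A] (hsink : NoSinks V) (f : L2 (PathSpace V))
    (u : PathSpace V) : Continuous (coordFunctional τ f u) := by
  by_contra hu
  let next : PathSpace V → PathSpace V := fun u =>
    PathSpace.prepend (hsink u.range).some.2 u.path
  let U : ℕ → PathSpace V := fun n => next^[n] u
  have hnext : ∀ n, U (n + 1) = next (U n) := fun n => Function.iterate_succ_apply' next n u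
  have hU : ∀ n, ¬ Continuous (coordFunctional τ f (U n)) := fun n => by
    induction n with
    | zero => exact hu
    | succ n ih =>
      rw [hnext]
      exact fun h => ih (continuous_coordFunctional_of_prepend τ _ (U n).path h)
  have hpath : ∀ n k, ∃ p : Quiver.Path (U n).range (U (n + k)).range, p.length = k := fun n k => by
    induction k with
    | zero => exact ⟨Quiver.Path.nil, rfl⟩
    | succ k ih =>
      obtain ⟨p, hp⟩ := ih
      rw [← add_assoc, hnext]
      exact ⟨p.cons (hsink (U (n + k)).range).some.2, congrArg (· + 1) hp⟩
  -- The start `z` is a variable tied by an equation, so that the equation can be substituted and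
  -- `p` becomes a closed path.
  have hcycle : ∀ (m : ℕ) (z : V) (p : Quiver.Path z (U m).range), z = (U m).range →
      p.length = 0 := by
    rintro m z p rfl
    by_contra hp
    exact hU m (continuous_coordFunctional_of_cycle τ (U m).path p hp)
  have hlt : ∀ n m, n < m → (U n).range ≠ (U m).range := fun n m hnm heq => by
    obtain ⟨k, rfl⟩ := Nat.exists_eq_add_of_lt hnm
    obtain ⟨p, hp⟩ := hpath n (k + 1)
    have h0 := hcycle (n + (k + 1)) _ p heq
    omega
  refine not_injective_range τ U hU fun n m h => ?_
  by_contra hne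
  rcases lt_or_gt_of_ne hne with h' | h'
  exacts [hlt n m h' h, hlt m n h' h.symm]

/-- Closed graph theorem: the coordinates of `τ(a) f` are continuous in `a` and determine `τ(a)`. -/
theorem continuous_algEquiv [CompleteSpace A] (hsink : NoSinks V) : Continuous τ := by
  refine LinearMap.continuous_of_seq_closed_graph (g := τ.toLinearMap) fun s x y hx hy => ?_
  refine Subtype.ext (ContinuousLinearMap.ext fun f => ?_)
  ext u
  have h1 := ((continuous_coordFunctional τ hsink f u).tendsto x).comp hx
  have h2 : Continuous fun B : freeSemigroupoidAlgebra V =>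
      (B : L2 (PathSpace V) →L[ℂ] L2 (PathSpace V)) f u := by
    simp only [← inner_basisVec]
    exact ((innerSL ℂ (basisVec u)).continuous.comp
      (ContinuousLinearMap.apply ℂ _ f).continuous).comp continuous_subtype_val
  exact tendsto_nhds_unique ((h2.tendsto y).comp hy) h1

end NormContinuity

/-! ### Continuity on bounded sets for the weak operator topologies -/

theorem tendsto_inner_mul_left {H : Type*} [NormedAddCommGroup H] [InnerProductSpace ℂ H]
    [CompleteSpace H] {ι : Type*} {l : Filter ι} {T : ι → H →L[ℂ] H} {T₀ : H →L[ℂ] H}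
    (h : ∀ x y, Filter.Tendsto (fun i => ⟪y, T i x⟫_ℂ) l (𝓝 ⟪y, T₀ x⟫_ℂ)) (K : H →L[ℂ] H)
    (x y : H) :
    Filter.Tendsto (fun i => ⟪y, (K * T i) x⟫_ℂ) l (𝓝 ⟪y, (K * T₀) x⟫_ℂ) := by
  simpa only [ContinuousLinearMap.adjoint_inner_left, mul_apply_eq_comp] using
    h x (ContinuousLinearMap.adjoint K y)

/-- Multiplication by a fixed left factor is weakly continuous, and only the right factors vary.
Finiteness of `E` permits taking the limit term by term. -/
theorem limit_expansion {H : Type*} [NormedAddCommGroup H] [InnerProductSpace ℂ H]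
    [CompleteSpace H] {ι E : Type*} [Fintype E] {l : Filter ι} [l.NeBot]
    {T : ι → H →L[ℂ] H} {T₀ : H →L[ℂ] H} {c : ι → ℂ} {c₀ : ℂ} {S : E → ι → H →L[ℂ] H}
    {S₀ : E → H →L[ℂ] H} (K : H →L[ℂ] H) (L : E → H →L[ℂ] H)
    (hT : ∀ x y, Filter.Tendsto (fun i => ⟪y, T i x⟫_ℂ) l (𝓝 ⟪y, T₀ x⟫_ℂ))
    (hc : Filter.Tendsto c l (𝓝 c₀))
    (hS : ∀ e x y, Filter.Tendsto (fun i => ⟪y, S e i x⟫_ℂ) l (𝓝 ⟪y, S₀ e x⟫_ℂ))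
    (h : ∀ i, K * T i = c i • K + ∑ e, L e * S e i) :
    K * T₀ = c₀ • K + ∑ e, L e * S₀ e := by
  refine ContinuousLinearMap.ext fun x => ext_inner_left ℂ fun y => ?_
  have h1 := tendsto_inner_mul_left hT K x y
  have h2 := (hc.mul_const ⟪y, K x⟫_ℂ).add
    (tendsto_finsetSum Finset.univ fun e _ => tendsto_inner_mul_left (hS e) (L e) x y)
  have h3 : ∀ i, c i * ⟪y, K x⟫_ℂ + ∑ e, ⟪y, (L e * S e i) x⟫_ℂ = ⟪y, (K * T i) x⟫_ℂ := fun i => by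
    rw [h, add_apply, smul_apply, sum_apply, inner_add_right, inner_smul_right, inner_sum]
  rw [tendsto_nhds_unique h1 (h2.congr h3), add_apply, smul_apply, sum_apply, inner_add_right,
    inner_smul_right, inner_sum]

/-- Coordinatewise convergence of a bounded family in `ℓ²` implies weak convergence. -/
theorem tendsto_inner_of_tendsto_coord {ι κ : Type*} {l : Filter κ} {g : κ → L2 ι} {g₀ : L2 ι}
    {C : ℝ} (hg : ∀ i, ‖g i‖ ≤ C) (h : ∀ u, Filter.Tendsto (fun i => g i u) l (𝓝 (g₀ u)))
    (y : L2 ι) : Filter.Tendsto (fun i => ⟪y, g i⟫_ℂ) l (𝓝 ⟪y, g₀⟫_ℂ) := by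
  classical
  have hsingle : ∀ s : Finset ι, Filter.Tendsto (fun i => ⟪∑ u ∈ s, lp.single 2 u (y u), g i⟫_ℂ) l
      (𝓝 ⟪∑ u ∈ s, lp.single 2 u (y u), g₀⟫_ℂ) := fun s => by
    simp only [sum_inner, lp.inner_single_left]
    refine tendsto_finsetSum s fun u _ => ?_
    simpa using (h u).mul_const ((starRingEnd ℂ) (y u))
  have hy : Filter.Tendsto (fun s : Finset ι => ∑ u ∈ s, lp.single 2 u (y u)) Filter.atTop (𝓝 y) :=
    lp.hasSum_single (by norm_num) y
  -- The bound on `‖g i‖` makes the truncation error in `y` uniform in `i`, so the two limits may be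
  -- exchanged.
  have hunif : TendstoUniformly (fun (s : Finset ι) i => ⟪∑ u ∈ s, lp.single 2 u (y u), g i⟫_ℂ)
      (fun i => ⟪y, g i⟫_ℂ) Filter.atTop := by
    rw [Metric.tendstoUniformly_iff]
    intro ε hε
    have hδ : 0 < ε / (|C| + 1) := by positivity
    filter_upwards [Metric.tendsto_nhds.1 hy _ hδ] with s hs i
    rw [dist_eq_norm, ← inner_sub_left]
    rw [dist_eq_norm, norm_sub_rev] at hs
    calc _ ≤ ‖y - ∑ u ∈ s, lp.single 2 u (y u)‖ * ‖g i‖ := norm_inner_le_norm _ _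
      _ ≤ ‖y - ∑ u ∈ s, lp.single 2 u (y u)‖ * (|C| + 1) := by
        gcongr
        linarith [hg i, le_abs_self C]
      _ < ε / (|C| + 1) * (|C| + 1) := by gcongr
      _ = ε := by field_simp
  have hlim : Filter.Tendsto (fun s : Finset ι => ⟪∑ u ∈ s, lp.single 2 u (y u), g₀⟫_ℂ)
      Filter.atTop (𝓝 ⟪y, g₀⟫_ℂ) := hy.inner tendsto_const_nhds
  exact hunif.tendsto_of_eventually_tendsto
    (Filter.Eventually.of_forall hsingle) hlim

variable {V' : Type u'} [Quiver.{v'} V']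

variable (V) in
/-- The bounded operators on `ℓ²(𝔽⁺(G))`. -/
abbrev Op : Type _ := L2 (PathSpace V) →L[ℂ] L2 (PathSpace V)

/-- The quotient by an edge, as an element of the algebra. -/
def edgeQuotientElem {a b : V} (e : a ⟶ b) (B : freeSemigroupoidAlgebra V) :
    freeSemigroupoidAlgebra V := ⟨edgeQuotient e B, edgeQuotient_mem e B.2⟩

/-- The operator `L_e`, as an element of the algebra. -/
def creationElem {a b : V} (e : a ⟶ b) : freeSemigroupoidAlgebra V := ⟨creation e, creation_mem e⟩

/-- The projection `P_x`, as an element of the algebra. -/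
def vertexProjElem (x : V) : freeSemigroupoidAlgebra V := ⟨vertexProj x, vertexProj_mem x⟩

theorem coe_expansion {E : Type*} [Fintype E] (K T : freeSemigroupoidAlgebra V)
    (c : ℂ) (L S : E → freeSemigroupoidAlgebra V) :
    K * T = c • K + ∑ e, L e * S e ↔
      (K : Op V) * (T : Op V) = c • (K : Op V) + ∑ e, (L e : Op V) * (S e : Op V) := by
  have h1 : ((∑ e, L e * S e : freeSemigroupoidAlgebra V) : Op V) =
      ∑ e, (L e : Op V) * (S e : Op V) := map_sum (freeSemigroupoidAlgebra V).val _ _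
  rw [← h1, ← Subtype.coe_inj]
  rfl

theorem vertexProjElem_mul_eq (y : V) [Fintype (Quiver.Costar y)] (B : freeSemigroupoidAlgebra V) :
    vertexProjElem y * B = vertexCoeff y (B : Op V) • vertexProjElem y +
      ∑ e : Quiver.Costar y, creationElem e.2 * edgeQuotientElem e.2 B :=
  (coe_expansion _ _ _ _ _).2 (vertexProj_mul_eq y (mem_vertexEigenAlgebra B.2))

theorem map_expansion {A B E : Type*} [Fintype E] [Ring A] [Algebra ℂ A] [Ring B] [Algebra ℂ B]
    (σ : A →ₐ[ℂ] B) {K T : A} {c : ℂ} {L S : E → A} (h : K * T = c • K + ∑ e, L e * S e) :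
    σ K * σ T = c • σ K + ∑ e, σ (L e) * σ (S e) := by
  rw [← map_mul, h, map_add, map_smul, map_sum]
  simp only [map_mul]

section

variable (τ : freeSemigroupoidAlgebra V ≃ₐ[ℂ] freeSemigroupoidAlgebra V')

theorem exists_bound_of_continuous {A B : Type*} [NormedAddCommGroup A] [NormedSpace ℂ A]
    [NormedAddCommGroup B] [NormedSpace ℂ B] (τ : A →ₗ[ℂ] B) (h : Continuous τ) :
    ∃ M, 0 ≤ M ∧ ∀ a, ‖τ a‖ ≤ M * ‖a‖ :=
  let T : A →L[ℂ] B := ⟨τ, h⟩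
  ⟨‖T‖, norm_nonneg _, T.le_opNorm⟩

theorem exists_norm_le_of_continuous {A B ι : Type*} [NormedAddCommGroup A] [NormedSpace ℂ A]
    [NormedAddCommGroup B] [NormedSpace ℂ B] (τ : A →ₗ[ℂ] B) (h : Continuous τ) {a : ι → A} {C : ℝ}
    (ha : ∀ i, ‖a i‖ ≤ C) : ∃ C', 0 ≤ C' ∧ ∀ i, ‖τ (a i)‖ ≤ C' := by
  obtain ⟨M, hM0, hM⟩ := exists_bound_of_continuous τ h
  refine ⟨M * |C|, by positivity, fun i => (hM _).trans ?_⟩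
  gcongr
  exact (ha i).trans (le_abs_self C)

theorem exists_limit_vertexCoeff (y : V) {ι : Type*} (U : Ultrafilter ι) {B : ι → Op V} {C : ℝ}
    (hB : ∀ i, ‖B i‖ ≤ C) : ∃ c, Filter.Tendsto (fun i => vertexCoeff y (B i)) U (𝓝 c) := by
  obtain ⟨z, -, hz⟩ := (isCompact_closedBall (0 : ℂ) C).ultrafilter_le_nhds
    (U.map fun i => vertexCoeff y (B i)) (by
      rw [Filter.le_principal_iff]
      exact Filter.Eventually.of_forall (f := (U : Filter ι)) fun i => by
        simpa using (norm_vertexCoeff_le y _).trans (hB i))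
  exact ⟨z, hz⟩

/-- Norm continuity of `τ⁻¹` keeps the pulled-back quotients bounded, so they have a weak limit
along `U`, and the algebra is weakly closed. -/
theorem exists_limit_edgeQuotient (hτ' : Continuous τ.symm) {y z : V'} (e : z ⟶ y) {ι : Type*}
    (U : Ultrafilter ι) {B : ι → freeSemigroupoidAlgebra V'} {C : ℝ} (hB : ∀ i, ‖B i‖ ≤ C) :
    ∃ (a : freeSemigroupoidAlgebra V) (C' : ℝ),
      (∀ i, ‖τ.symm (edgeQuotientElem e (B i))‖ ≤ C') ∧
      ∀ x z, Filter.Tendsto (fun i => ⟪z, (τ.symm (edgeQuotientElem e (B i)) : Op V) x⟫_ℂ) U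
        (𝓝 ⟪z, (a : Op V) x⟫_ℂ) := by
  have hbound : ∀ i, ‖edgeQuotientElem e (B i)‖ ≤ 2 * ‖(annihilation e : Op V')‖ * |C| :=
    fun i => (norm_edgeQuotient_le e _).trans (by
      gcongr
      exact (hB i).trans (le_abs_self C))
  obtain ⟨C', hC', h⟩ := exists_norm_le_of_continuous τ.symm.toLinearMap hτ' hbound
  obtain ⟨a, ha⟩ := exists_wot_limit U
    (fun i => (τ.symm (edgeQuotientElem e (B i)) : Op V)) C' hC' h
  exact ⟨⟨a, mem_wotClosure_of_tendsto (fun i => (τ.symm _).2) ha⟩, C', h, ha⟩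

/-- The limit is taken on the side of `V`, where `A i → A₀` is known; the limiting identity is
purely algebraic and can be sent back through `τ`. No weak continuity of `τ` enters. -/
theorem exists_limit_expansion (hτ : Continuous τ) (hτ' : Continuous τ.symm) (y : V')
    [Fintype (Quiver.Costar y)] {ι : Type*} (U : Ultrafilter ι)
    (A : ι → freeSemigroupoidAlgebra V) (A₀ : freeSemigroupoidAlgebra V) (C : ℝ)
    (hA : ∀ i, ‖A i‖ ≤ C)
    (hlim : ∀ x z, Filter.Tendsto (fun i => ⟪z, (A i : Op V) x⟫_ℂ) U (𝓝 ⟪z, (A₀ : Op V) x⟫_ℂ)) :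
    ∃ (c : ℂ) (a : Quiver.Costar y → freeSemigroupoidAlgebra V) (C' : Quiver.Costar y → ℝ),
      Filter.Tendsto (fun i => vertexCoeff y (τ (A i) : Op V')) U (𝓝 c) ∧
      (∀ (e : Quiver.Costar y) i, ‖τ.symm (edgeQuotientElem e.2 (τ (A i)))‖ ≤ C' e) ∧
      (∀ (e : Quiver.Costar y) x z, Filter.Tendsto
        (fun i => ⟪z, (τ.symm (edgeQuotientElem e.2 (τ (A i))) : Op V) x⟫_ℂ) U
        (𝓝 ⟪z, (a e : Op V) x⟫_ℂ)) ∧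
      vertexProj y * (τ A₀ : Op V') = c • vertexProj y +
        ∑ e : Quiver.Costar y, creation e.2 * (τ (a e) : Op V') := by
  obtain ⟨CB, -, hB⟩ := exists_norm_le_of_continuous τ.toLinearMap hτ hA
  obtain ⟨c, hc⟩ := exists_limit_vertexCoeff y U (B := fun i => (τ (A i) : Op V')) hB
  choose a C' hC' ha using fun e : Quiver.Costar y => exists_limit_edgeQuotient τ hτ' e.2 U hB
  refine ⟨c, a, C', hc, hC', ha, ?_⟩
  have hexp : ∀ i, _ := fun i =>
    (coe_expansion _ _ _ _ _).1 (map_expansion τ.symm.toAlgHom (vertexProjElem_mul_eq y (τ (A i))))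
  have hexp' : ∀ i, (τ.symm (vertexProjElem y) : Op V) * (A i : Op V) =
      vertexCoeff y (τ (A i) : Op V') • (τ.symm (vertexProjElem y) : Op V) +
        ∑ e : Quiver.Costar y, (τ.symm (creationElem e.2) : Op V) *
          (τ.symm (edgeQuotientElem e.2 (τ (A i))) : Op V) := fun i => by
    have h := hexp i
    rw [show τ.symm.toAlgHom (τ (A i)) = A i from τ.symm_apply_apply _] at h
    exact h
  have hmain := limit_expansion _ _ hlim hc ha hexp'
  have h4 := (coe_expansion _ _ _ _ _).1 (map_expansion τ.toAlgHom ((coe_expansion _ _ _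
    (fun e : Quiver.Costar y => τ.symm (creationElem e.2)) _).2 hmain))
  rw [show τ.toAlgHom (τ.symm (vertexProjElem y)) = vertexProjElem y from
    τ.apply_symm_apply _] at h4
  refine h4.trans ?_
  congr 1
  refine Finset.sum_congr rfl fun e _ => ?_
  rw [show τ.toAlgHom (τ.symm (creationElem e.2)) = creationElem e.2 from τ.apply_symm_apply _]
  rfl

/-- Induction on the path `p`. The family `A` is quantified inside, since the step for `e p` applies
the hypothesis to the family `τ⁻¹` of the quotients of `τ(A i)` by `e`. -/
theorem tendsto_coord_of_wot (hτ : Continuous τ) (hτ' : Continuous τ.symm)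
    (hfin : ∀ y : V', Finite (Quiver.Costar y)) {ι : Type*} (U : Ultrafilter ι) {x y : V'}
    (p : Quiver.Path x y) :
    ∀ (A : ι → freeSemigroupoidAlgebra V) (A₀ : freeSemigroupoidAlgebra V) (C : ℝ)
      (_ : ∀ i, ‖A i‖ ≤ C)
      (_ : ∀ x z, Filter.Tendsto
        (fun i => ⟪z, (A i : Op V) x⟫_ℂ) U
        (𝓝 ⟪z, (A₀ : Op V) x⟫_ℂ)) (f : L2 (PathSpace V')),
      Filter.Tendsto (fun i => (τ (A i) : Op V') f ⟨x, y, p⟩) U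
        (𝓝 ((τ A₀ : Op V') f ⟨x, y, p⟩)) := by
  classical
  -- Applying `φ_y` to the limiting expansion kills every `L_e` term, which identifies the limit `c`
  -- as `φ_y(τ A₀)`.
  have hcoeff : ∀ (y : V') (A : ι → freeSemigroupoidAlgebra V) (A₀ : freeSemigroupoidAlgebra V)
      (C : ℝ) (_ : ∀ i, ‖A i‖ ≤ C)
      (_ : ∀ x z, Filter.Tendsto
        (fun i => ⟪z, (A i : Op V) x⟫_ℂ) U
        (𝓝 ⟪z, (A₀ : Op V) x⟫_ℂ)),
      Filter.Tendsto (fun i => vertexCoeff y (τ (A i) : Op V')) U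
        (𝓝 (vertexCoeff y (τ A₀ : Op V'))) := by
    intro y A A₀ C hA hlim
    have := Fintype.ofFinite (Quiver.Costar y)
    obtain ⟨c, a, C', h1, -, -, h4⟩ := exists_limit_expansion τ hτ hτ' y U A A₀ C hA hlim
    have h5 := congrArg (vertexCoeff y) h4
    have h6 : ∀ (e : Quiver.Costar y) (B : Op V'),
        vertexCoeff y (creation e.2 * B) = 0 := fun e B => rfl
    rw [vertexCoeff_mul y (mem_vertexEigenAlgebra (vertexProj_mem y)), map_add, map_smul, map_sum,
      Finset.sum_eq_zero fun e _ => h6 e _, vertexCoeff_vertexProj, if_pos rfl] at h5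
    simp only [one_mul, smul_eq_mul, mul_one, add_zero] at h5
    rw [h5]
    exact h1
  induction p with
  | nil =>
    intro A A₀ C hA hlim f
    have h1 : ∀ B : freeSemigroupoidAlgebra V', (B : Op V') f ⟨x, x, .nil⟩ =
        vertexCoeff x (B : Op V') * f (PathSpace.vertex x) :=
      fun B => mem_vertexEigenAlgebra B.2 x f
    simp only [h1]
    exact (hcoeff x A A₀ C hA hlim).mul_const _
  | @cons b y p e ih =>
    intro A A₀ C hA hlim f
    have := Fintype.ofFinite (Quiver.Costar y)
    obtain ⟨c, a, C', h1, h2, h3, h4⟩ := exists_limit_expansion τ hτ hτ' y U A A₀ C hA hlim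
    have h5 := ih _ (a ⟨b, e⟩) (C' ⟨b, e⟩) (h2 ⟨b, e⟩) (h3 ⟨b, e⟩) f
    simp only [AlgEquiv.apply_symm_apply] at h5
    have h6 : ∀ i, (τ (A i) : Op V') f (PathSpace.prepend e p) =
        (edgeQuotientElem e (τ (A i)) : Op V') f ⟨x, b, p⟩ +
        vertexCoeff y (τ (A i) : Op V') * f (PathSpace.prepend e p) :=
      fun i => by
        rw [edgeQuotientElem, edgeQuotient_apply_coord]
        ring
    -- At the coordinate `e p` only the summand of `e` contributes, so the limiting expansion
    -- mirrors `h6` term by term.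
    have h7 : (τ A₀ : Op V') f (PathSpace.prepend e p) =
        (τ (a ⟨b, e⟩) : Op V') f ⟨x, b, p⟩ + c * f (PathSpace.prepend e p) := by
      have h8 := congrArg (fun T : Op V' =>
        ⟪basisVec (PathSpace.prepend e p), T f⟫_ℂ) h4
      simp only [add_apply, smul_apply, sum_apply, inner_add_right, inner_sum, inner_smul_right,
        inner_basisVec, mul_apply_eq_comp] at h8
      rw [vertexProj_apply, vertexProj_apply,
        if_pos (show (PathSpace.prepend e p).range = y from rfl),
        if_pos (show (PathSpace.prepend e p).range = y from rfl),
        Finset.sum_eq_single (⟨b, e⟩ : Quiver.Costar y)] at h8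
      · rw [h8, creation_apply_prepend, add_comm]
      · rintro ⟨b', e'⟩ - hne
        refine creation_apply_prepend_of_ne e' e p _ fun heq => hne ?_
        cases heq
        rfl
      · simp
    change Filter.Tendsto (fun i => (τ (A i) : Op V') f
      (PathSpace.prepend e p)) U (𝓝 ((τ A₀ : Op V') f (PathSpace.prepend e p)))
    simp only [h6, h7]
    exact h5.add (h1.mul_const _)

end

/-! ### Weak-star continuity -/

section

variable {H : Type*} [NormedAddCommGroup H] [InnerProductSpace ℂ H]

omit [InnerProductSpace ℂ H] in
theorem summable_norm_mul_norm (x y : lp (fun _ : ℕ => H) 2) :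
    Summable fun n => ‖x n‖ * ‖y n‖ := by
  have h : ∀ z : lp (fun _ : ℕ => H) 2, Summable fun n => ‖z n‖ ^ 2 := fun z => by
    simpa using (lp.memℓp z).summable (by norm_num)
  refine Summable.of_nonneg_of_le (fun n => by positivity) (fun n => ?_) ((h x).add (h y))
  nlinarith [sq_nonneg (‖x n‖ - ‖y n‖), sq_nonneg ‖x n‖, sq_nonneg ‖y n‖]

theorem norm_inner_apply_le (T : H →L[ℂ] H) (x y : H) : ‖⟪y, T x⟫_ℂ‖ ≤ ‖T‖ * (‖x‖ * ‖y‖) :=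
  calc _ ≤ ‖y‖ * ‖T x‖ := norm_inner_le_norm _ _
    _ ≤ ‖y‖ * (‖T‖ * ‖x‖) := by gcongr; exact T.le_opNorm x
    _ = _ := by ring

/-- The ultraweakly continuous functional `T ↦ ∑ₙ ⟪yₙ, T xₙ⟫`. -/
def weakStarFunctional (x y : lp (fun _ : ℕ => H) 2) : StrongDual ℂ (H →L[ℂ] H) :=
  LinearMap.mkContinuous
    { toFun := fun T => ∑' n, ⟪y n, T (x n)⟫_ℂ
      map_add' := fun S T => by
        rw [← (summable_weakStar S x y).tsum_add (summable_weakStar T x y)]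
        simp
      map_smul' := fun c T => by
        simp only [RingHom.id_apply]
        rw [← (summable_weakStar T x y).tsum_const_smul c]
        simp }
    (∑' n, ‖x n‖ * ‖y n‖) fun T => by
      rw [mul_comm]
      exact tsum_of_norm_bounded ((summable_norm_mul_norm x y).hasSum.mul_left ‖T‖)
        fun n => norm_inner_apply_le T _ _

theorem weakStarFunctional_apply (x y : lp (fun _ : ℕ => H) 2) (T : H →L[ℂ] H) :
    weakStarFunctional x y T = ∑' n, ⟪y n, T (x n)⟫_ℂ := rfl

/-- On bounded sets weak operator convergence implies ultraweak convergence, by dominated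
convergence with majorant `C ‖xₙ‖ ‖yₙ‖`. -/
theorem tendsto_weakStarFunctional (x y : lp (fun _ : ℕ => H) 2) {ι : Type*} {l : Filter ι}
    {T : ι → H →L[ℂ] H} {T₀ : H →L[ℂ] H} {C : ℝ} (hT : ∀ i, ‖T i‖ ≤ C)
    (h : ∀ x y, Filter.Tendsto (fun i => ⟪y, T i x⟫_ℂ) l (𝓝 ⟪y, T₀ x⟫_ℂ)) :
    Filter.Tendsto (fun i => weakStarFunctional x y (T i)) l (𝓝 (weakStarFunctional x y T₀)) := by
  refine tendsto_tsum_of_dominated_convergence ((summable_norm_mul_norm x y).mul_left C)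
    (fun n => h (x n) (y n)) (Filter.Eventually.of_forall fun i n => ?_)
  refine (norm_inner_apply_le (T i) _ _).trans ?_
  gcongr
  exact hT i

theorem continuous_weakStarFunctional (x y : lp (fun _ : ℕ => H) 2) :
    Continuous[weakStarTopology H, inferInstance] (weakStarFunctional x y) :=
  continuous_iInf_dom (i := (x, y)) continuous_induced_dom

end

variable (V) in
/-- The inclusion of the free semigroupoid algebra into the bounded operators. -/
def inclusion : freeSemigroupoidAlgebra V →ₗᵢ[ℂ] Op V :=
  ⟨(freeSemigroupoidAlgebra V).val.toLinearMap, fun _ => rfl⟩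

theorem isClosed_wot_range_inclusion :
    IsClosed {T : L2 (PathSpace V) →WOT[ℂ] L2 (PathSpace V) |
      T.toCLM ∈ Set.range (inclusion V)} := by
  have h : Set.range (inclusion V) = (freeSemigroupoidAlgebra V : Set (Op V)) :=
    Subtype.range_coe
  rw [h]
  exact isClosed_wot_freeSemigroupoidAlgebra

/-- The pre-adjoint of `τ`: composition with `τ` maps w*-continuous functionals to w*-continuous
functionals. -/
theorem exists_weakStarFunctional_comp
    (τ : freeSemigroupoidAlgebra V ≃ₐ[ℂ] freeSemigroupoidAlgebra V')
    (hsink : NoSinks V) (hsink' : NoSinks V') (hfin : ∀ y : V', Finite (Quiver.Costar y))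
    (x y : lp (fun _ : ℕ => L2 (PathSpace V')) 2) :
    ∃ x' y' : lp (fun _ : ℕ => L2 (PathSpace V)) 2, ∀ A : freeSemigroupoidAlgebra V,
      weakStarFunctional x y (τ A : Op V') = weakStarFunctional x' y' (A : Op V) := by
  have hτ : Continuous τ := continuous_algEquiv τ hsink'
  have hτ' : Continuous τ.symm := continuous_algEquiv τ.symm hsink
  let σ : freeSemigroupoidAlgebra V →L[ℂ] freeSemigroupoidAlgebra V' := ⟨τ.toLinearMap, hτ⟩
  let g : StrongDual ℂ (freeSemigroupoidAlgebra V) :=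
    (weakStarFunctional x y).comp ((inclusion V').toContinuousLinearMap.comp σ)
  obtain ⟨a, ha⟩ := mem_range_predualMap (isClosed_wot_range_inclusion (V := V)) g
    -- It suffices to test convergence on ultrafilters, along which the coordinate result applies
    -- with limit `A₀ = 0`.
    fun T hT1 hT => by
      rw [Filter.tendsto_iff_ultrafilter]
      intro U hU
      obtain ⟨C, -, hC⟩ := exists_norm_le_of_continuous τ.toLinearMap hτ hT1
      have hlim : ∀ f h, Filter.Tendsto (fun i => ⟪h, (τ (T i) : Op V') f⟫_ℂ) U
          (𝓝 ⟪h, ((0 : Op V') f)⟫_ℂ) := fun f h => by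
        refine tendsto_inner_of_tendsto_coord (C := C * ‖f‖)
          (fun i => (τ (T i) : Op V').le_of_opNorm_le (hC i) f) (fun u => ?_) h
        have h1 := tendsto_coord_of_wot τ hτ hτ' hfin U u.path T 0 1 hT1 (fun x z => by
          rw [ZeroMemClass.coe_zero, zero_apply, inner_zero_right]
          exact (hT x z).mono_left hU) f
        rw [map_zero] at h1
        exact h1
      have h2 := tendsto_weakStarFunctional x y (T := fun i => (τ (T i) : Op V')) hC hlim
      rw [map_zero] at h2
      exact h2
  obtain ⟨x', y', h⟩ := exists_lp_of_predualMap (inclusion V) a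
  refine ⟨x', y', fun A => ?_⟩
  rw [weakStarFunctional_apply x' y']
  refine Eq.trans ?_ (h A)
  rw [ha]
  rfl

end GraphAlgebra

end

open GraphAlgebra in
theorem mainTheorem7
    {V : Type u} [Quiver.{v, u} V] [Countable V]
    {V' : Type u'} [Quiver.{v', u'} V'] [Countable V']
    (hE : CountableEdges V) (hE' : CountableEdges V')
    (hfin : LocallyFinite V) (hfin' : LocallyFinite V')
    (hsink : NoSinks V) (hsink' : NoSinks V')
    (τ : freeSemigroupoidAlgebra V ≃ₐ[ℂ] freeSemigroupoidAlgebra V') :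
    Continuous[freeSemigroupoidAlgebra.weakStar V, freeSemigroupoidAlgebra.weakStar V'] τ := by
  -- The target topology is initial for the functionals `weakStarFunctional`, so each of them
  -- composed with `τ` is tested separately.
  refine continuous_induced_rng.2 (continuous_iInf_rng.2 fun p => continuous_induced_rng.2 ?_)
  obtain ⟨x, y, h⟩ := exists_weakStarFunctional_comp τ hsink hsink' (fun y => (hfin' y).2) p.1 p.2
  have h1 : Continuous[freeSemigroupoidAlgebra.weakStar V, inferInstance]
      fun A : freeSemigroupoidAlgebra V =>
        weakStarFunctional x y (A : L2 (PathSpace V) →L[ℂ] L2 (PathSpace V)) :=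
    @Continuous.comp _ _ _ (freeSemigroupoidAlgebra.weakStar V) (weakStarTopology _) _ _ _
      (continuous_weakStarFunctional x y) continuous_induced_dom
  convert h1 using 1
  funext A
  exact h A
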